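/- Setting. A two-sided partial-observation stochastic game $G$ consists of finite sets $Q$ (states), $A_1,A_2$ (actions), a transition function $\delta:Q\times A_1\times A_2\to\mathcal D(Q)$ ($\mathcal D(X)$ is the set of probability distributions on $X$) and two equivalence relations $\approx_1,\approx_2$ on $Q$; the classes of $\approx_i$ are the observations of player $i$, and actions are invisible. In each round the players simultaneously choose actions $a,b$ and the next state is drawn from $\delta(q,a,b)$. A pure (randomized) strategy of player $i$ maps each finite sequence of visited states to an action (a distribution on actions); it is observation-based if its value depends only on the sequence of classes modulo $\approx_i$. A pure strategy $\sigma$ of player 1 has finite memory if there are a finite set $\mathrm{Mem}$, $m_0\in \mathrm{Mem}$, and maps $\alpha_u$ from pairs (memory value, observation of player 1) to $\mathrm{Mem}$ and $\alpha_n$ from such pairs to $A_1$ with $\sigma(\rho\cdot q)=\alpha_n(\hat\alpha_u(m_0,\mathrm{obs}_1(\rho)),\mathrm{obs}_1(q))$ for every finite (possibly empty) sequence of states $\rho$ and every state $q$, where $\hat\alpha_u$ extends $\alpha_u$ to observation sequences; $|\mathrm{Mem}|$ is the size of the memory. $\Pr_q^{\sigma,\pi}$ is the law of the play from $q$. $\mathsf{Reach}(\mathcal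 T)$ is the set of plays that visit $\mathcal T$, $\mathsf{Safe}(S)$ the set of plays that stay in $S$ forever. A pure observation-based strategy $\sigma$ of player 1 is positive (resp. almost-sure) winning from $q$ for $\varphi$ if $\Pr_q^{\sigma,\pi}(\varphi)>0$ (resp. $=1$) for all observation-based randomized strategies $\pi$ of player 2. Theorem. (1) For every such game, every state $q$ and all $\mathcal T,S\subseteq Q$: if player 1 has a pure observation-based strategy that is positive winning from $q$ for $\mathsf{Reach}(\mathcal T)$ and almost-sure winning from $q$ for $\mathsf{Safe}(S)$, then player 1 has a finite-memory pure observation-based strategy with the same two properties. (2) For every such game, every $q$ and every $\mathcal T\subseteq Q$: if player 1 has a pure observation-based positive winning strategy from $q$ for $\mathsf{Reach}(\mathcal T)$, then player 1 has one with finite memory. (3) Non-elementary memory is required in general for (2): let $\mathrm{tow}_0(x)=x$ and $\mathrm{tow}_{k+1}(x)=2^{\mathrm{tow}_k(x)}$. For every $k\in\mathbb N$ there are a game $G$, a state $q$ and a target set $\mathcal T$ such that player 1 has a pure observation-based positive winning strategy from $q$ for $\mathsf{Reach}(\mathcal T)$, but every finite-memory pure strategy that is positive winning from $q$ for $\mathsf{Reach}(\mathcal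 T)$ has memory of size greater than $\mathrm{tow}_k(|Q|+|A_1|+|A_2|)$. -/

import Mathlib

open MeasureTheory ProbabilityTheory
open scoped ENNReal

noncomputable section

namespace PartialObs

/-- A two-sided partial-observation stochastic game with state space `Q` and action alphabets
`A₁`, `A₂`. In every round both players choose an action simultaneously and the next state is drawn
from `trans q a b`. Player `i` observes a state only through its class modulo `obsᵢ`;
actions are invisible. (The initial state is a parameter of the notions below.) -/
structure Game (Q : Type*) (A₁ : Type*) (A₂ : Type*) where
  /-- the probabilistic transition function -/
  trans : Q → A₁ → A₂ → PMF Q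
  /-- indistinguishability of states for player 1 -/
  obs₁ : Setoid Q
  /-- indistinguishability of states for player 2 -/
  obs₂ : Setoid Q

/-- The observation of a state: its equivalence class. -/
abbrev Obs {Q : Type*} (s : Setoid Q) : Type _ := Quotient s

/-- The observation map of a player whose indistinguishability relation is `s`. -/
abbrev obs {Q : Type*} (s : Setoid Q) : Q → Obs s := Quotient.mk s

/-- A rule that assigns an element of `C` to every play prefix `ρ · q`, written as the list `ρ` of
the earlier states (oldest first) and the current state `q`. With `C` the set of actions this is a
pure strategy, with `C` the distributions on actions a randomized strategy. -/
abbrev Rule (Q : Type*) (C : Type*) : Type _ := List Q → Q → C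

/-- Pure strategies. -/
abbrev PureStrategy (Q : Type*) (A : Type*) : Type _ := Rule Q A

/-- Randomized strategies. -/
abbrev RandStrategy (Q : Type*) (A : Type*) : Type _ := Rule Q (PMF A)

/-- A strategy is observation-based if it takes the same value after any two play prefixes that
have the same observation sequence. -/
def ObservationBased {Q C : Type*} (s : Setoid Q) (σ : Rule Q C) : Prop :=
  ∀ (ρ ρ' : List Q) (q q' : Q),
    ρ.map (obs s) = ρ'.map (obs s) → obs s q = obs s q' → σ ρ q = σ ρ' q'

/-- A deterministic transducer with pure outputs: memory `Mem`, initial memory value, update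
function and next-move function, reading the observations in `O`. -/
structure Transducer (O : Type*) (A : Type*) (Mem : Type*) where
  /-- initial memory value -/
  init : Mem
  /-- update function -/
  update : Mem → O → Mem
  /-- next-move function -/
  next : Mem → O → A

/-- The pure strategy defined by a transducer: after the prefix `ρ · q` the memory has been updated
along the observations of `ρ`, and the next move depends on this memory and on the observation
of `q`. -/
def Transducer.strategy {Q A Mem : Type*} {s : Setoid Q} (τ : Transducer (Obs s) A Mem) :
    PureStrategy Q A :=
  fun ρ q => τ.next ((ρ.map (obs s)).foldl τ.update τ.init) (obs s q)

/-- A pure strategy uses finite memory if it is defined by a transducer with a finite memory. -/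
def FiniteMemory {Q A : Type*} (s : Setoid Q) (σ : PureStrategy Q A) : Prop :=
  ∃ (Mem : Type) (_ : Finite Mem) (τ : Transducer (Obs s) A Mem), σ = τ.strategy

variable {Q : Type*} {A₁ : Type*} {A₂ : Type*}

/-- The distribution of the next state after the play prefix `ρ · q`, when player 1 plays the pure
strategy `σ` and player 2 the randomized strategy `π`. -/
def Game.nextState (G : Game Q A₁ A₂) (σ : PureStrategy Q A₁) (π : RandStrategy Q A₂)
    (ρ : List Q) (q : Q) : PMF Q :=
  (π ρ q).bind fun b => G.trans q (σ ρ q) b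

/-- The states `q₀, …, q_{n-1}` visited before time `n`, as a list. -/
def pastStates {n : ℕ} (h : (i : Finset.Iic n) → Q) : List Q :=
  List.ofFn fun i : Fin n => h ⟨i, Finset.mem_Iic.2 i.isLt.le⟩

/-- The state `q_n` at time `n`. -/
def currentState {n : ℕ} (h : (i : Finset.Iic n) → Q) : Q :=
  h ⟨n, Finset.mem_Iic.2 le_rfl⟩

/-- The Markov kernel that draws the state at time `n + 1` given the states up to time `n`. -/
def Game.stepKernel [Finite Q] [MeasurableSpace Q] [MeasurableSingletonClass Q]
    (G : Game Q A₁ A₂) (σ : PureStrategy Q A₁) (π : RandStrategy Q A₂) (n : ℕ) :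
    Kernel ((i : Finset.Iic n) → Q) Q :=
  Kernel.ofFunOfCountable fun h =>
    (G.nextState σ π (pastStates h) (currentState h)).toMeasure

instance [Finite Q] [MeasurableSpace Q] [MeasurableSingletonClass Q]
    (G : Game Q A₁ A₂) (σ : PureStrategy Q A₁) (π : RandStrategy Q A₂) (n : ℕ) :
    IsMarkovKernel (G.stepKernel σ π n) :=
  ⟨fun h => PMF.toMeasure.isProbabilityMeasure
    (G.nextState σ π (pastStates h) (currentState h))⟩

/-- The law of the play, viewed as an infinite sequence of states, from the initial state `q`
(constructed from the step kernels by the Ionescu-Tulcea theorem). -/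
def Game.playMeasure [Finite Q] [MeasurableSpace Q] [MeasurableSingletonClass Q]
    (G : Game Q A₁ A₂) (q : Q) (σ : PureStrategy Q A₁) (π : RandStrategy Q A₂) :
    Measure (ℕ → Q) :=
  Kernel.traj (X := fun _ => Q) (fun n => G.stepKernel σ π n) 0 (fun _ => q)

/-- The probability of the objective `φ` from the initial state `q` under the strategies `σ`
and `π`; the finite state space carries the discrete σ-algebra. -/
def Game.prob [Finite Q] (G : Game Q A₁ A₂) (q : Q) (σ : PureStrategy Q A₁)
    (π : RandStrategy Q A₂) (φ : Set (ℕ → Q)) : ℝ≥0∞ :=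
  letI : MeasurableSpace Q := ⊤
  haveI : MeasurableSingletonClass Q := ⟨fun _ => trivial⟩
  G.playMeasure q σ π φ

/-- The reachability objective: the play visits `T`. -/
def Reach (T : Set Q) : Set (ℕ → Q) := {ρ | ∃ i, ρ i ∈ T}

/-- The safety objective: the play stays in `S` forever. -/
def Safe (S : Set Q) : Set (ℕ → Q) := {ρ | ∀ i, ρ i ∈ S}

/-- `σ` is positive winning from `q` for `φ`: against every observation-based (randomized) strategy
of player 2 the objective has positive probability. -/
def Game.PositiveWinning [Finite Q] (G : Game Q A₁ A₂) (q : Q) (σ : PureStrategy Q A₁)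
    (φ : Set (ℕ → Q)) : Prop :=
  ∀ π : RandStrategy Q A₂, ObservationBased G.obs₂ π → 0 < G.prob q σ π φ

/-- `σ` is almost-sure winning from `q` for `φ`: against every observation-based (randomized)
strategy of player 2 the objective has probability one. -/
def Game.AlmostSureWinning [Finite Q] (G : Game Q A₁ A₂) (q : Q) (σ : PureStrategy Q A₁)
    (φ : Set (ℕ → Q)) : Prop :=
  ∀ π : RandStrategy Q A₂, ObservationBased G.obs₂ π → G.prob q σ π φ = 1

/-- The tower of `k` exponentials with `x` on top: `2 ^ (2 ^ (⋯ ^ (2 ^ x)))`. A function is bounded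
by an elementary function iff it is bounded by `tower k` for some fixed `k`. -/
def tower : ℕ → ℕ → ℕ
  | 0, x => x
  | k + 1, x => 2 ^ tower k x

end PartialObs

end

/-! Both winning conditions depend only on which play prefixes have positive probability
(`Game.prob_reach_pos_iff`, `Game.prob_safe_eq_one_iff`). Probabilities thus disappear, and for
reachability player 2 may be taken deterministic (`Game.positiveWinning_reach_iff`).

Finite memory suffices: the deterministic strategies of player 2 form a compact space, so a positive
winning strategy reaches the target within some uniform number `N` of rounds. The new strategy
copies the old one for `N` rounds; from then on it pretends to have seen a fixed representative
among the histories with the same belief. Safety survives because it only requires beliefs to lie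
inside `S` (`Game.exists_finiteMemory`).

Non-elementary memory: think of all possible prefixes as tokens alive at the same time. In
`towerGame` player 2 can kill half of the active tokens per round, and wins by challenging once none
is left. Hence keeping an active token through `tower i 1` rounds of phase `i + 1` takes `2 ^ tower
i 1` active tokens, and these were emitted one per round in the preceding phase. Going back to the
first phase, the source has to stay there for `tower (K - 1) 1` rounds
(`not_positiveWinning_towerGame`). Its observation is constant meanwhile, so a transducer must count
these rounds (`Transducer.lt_card_of_first`). Conversely, staying that long suffices: the active
tokens then play all bit strings of the required length, and some token agrees with every answer of
player 2 (`TowerReached.castSucc`). -/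

namespace PartialObs

/-! ### Play prefixes of positive probability -/

section Possible

variable {Q A₁ A₂ : Type*}

/-- `G.Possible q₀ σ π ρ q` says that the play prefix `ρ · q` starts in `q₀` and has positive
probability under the strategies `σ` and `π`. -/
inductive Game.Possible (G : Game Q A₁ A₂) (q₀ : Q) (σ : PureStrategy Q A₁)
    (π : RandStrategy Q A₂) : List Q → Q → Prop
  | nil : Game.Possible G q₀ σ π [] q₀
  | snoc {ρ : List Q} {q q' : Q} : Game.Possible G q₀ σ π ρ q →
      q' ∈ (G.nextState σ π ρ q).support → Game.Possible G q₀ σ π (ρ ++ [q]) q'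

lemma Game.possible_nil_iff (G : Game Q A₁ A₂) {q₀ : Q} {σ : PureStrategy Q A₁}
    {π : RandStrategy Q A₂} {q : Q} : G.Possible q₀ σ π [] q ↔ q = q₀ := by
  constructor
  · generalize h : ([] : List Q) = l
    rintro (_ | _)
    · rfl
    · simp at h
  · rintro rfl
    exact .nil

lemma Game.possible_snoc_iff (G : Game Q A₁ A₂) {q₀ : Q} {σ : PureStrategy Q A₁}
    {π : RandStrategy Q A₂} {ρ : List Q} {q q' : Q} :
    G.Possible q₀ σ π (ρ ++ [q]) q' ↔
      G.Possible q₀ σ π ρ q ∧ q' ∈ (G.nextState σ π ρ q).support := by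
  constructor
  · generalize h : ρ ++ [q] = l
    rintro (_ | ⟨h1, h2⟩)
    · simp at h
    · obtain ⟨rfl, h3⟩ := List.append_inj' h rfl
      simp only [List.cons.injEq, and_true] at h3
      subst h3
      exact ⟨h1, h2⟩
  · rintro ⟨h1, h2⟩
    exact .snoc h1 h2

lemma Game.mem_support_nextState (G : Game Q A₁ A₂) {σ : PureStrategy Q A₁}
    {π : RandStrategy Q A₂} {ρ : List Q} {q q' : Q} :
    q' ∈ (G.nextState σ π ρ q).support ↔
      ∃ b ∈ (π ρ q).support, q' ∈ (G.trans q (σ ρ q) b).support := by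
  simp only [Game.nextState, PMF.mem_support_bind_iff]

lemma pastStates_succ {n : ℕ} (h : (i : Finset.Iic (n + 1)) → Q) :
    pastStates h = pastStates (Preorder.frestrictLe₂ (π := fun _ => Q) n.le_succ h) ++
      [currentState (Preorder.frestrictLe₂ (π := fun _ => Q) n.le_succ h)] := by
  unfold pastStates
  rw [List.ofFn_succ_last]
  rfl

lemma exists_pastStates_eq (ρ : List Q) (q : Q) :
    ∃ h : (i : Finset.Iic ρ.length) → Q, pastStates h = ρ ∧ currentState h = q := by
  refine ⟨fun i => (ρ ++ [q]).get ⟨i, ?_⟩, ?_, ?_⟩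
  · have := Finset.mem_Iic.1 i.2
    simp only [List.length_append, List.length_singleton]
    lia
  · apply List.ext_get
    · simp [pastStates]
    · intro n h1 h2
      simp [pastStates]
  · simp [currentState]

end Possible

/-! ### From the law of the play to possible prefixes -/

section PlayMeasure

variable {Q A₁ A₂ : Type*} [Finite Q] [MeasurableSpace Q] [MeasurableSingletonClass Q]

lemma Game.partialTraj_singleton_ne_zero_iff (G : Game Q A₁ A₂) (q₀ : Q) (σ : PureStrategy Q A₁)
    (π : RandStrategy Q A₂) (n : ℕ) (h : (i : Finset.Iic n) → Q) :
    Kernel.partialTraj (X := fun _ => Q) (fun n => G.stepKernel σ π n) 0 n (fun _ => q₀) {h} ≠ 0 ↔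
      G.Possible q₀ σ π (pastStates h) (currentState h) := by
  induction n with
  | zero =>
    rw [Kernel.partialTraj_self, Kernel.id_apply, Measure.dirac_apply' _ (measurableSet_singleton _)]
    have h0 : pastStates h = [] := by simp [pastStates]
    rw [h0, G.possible_nil_iff]
    simp only [ne_eq, Set.indicator_apply_eq_zero, Set.mem_singleton_iff, Pi.one_apply,
      one_ne_zero, imp_false, not_not]
    constructor
    · intro e
      rw [← e]
      rfl
    · rintro rfl
      funext i
      have : i = ⟨0, Finset.mem_Iic.2 le_rfl⟩ := by
        ext
        exact Nat.le_zero.1 (Finset.mem_Iic.1 i.2)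
      rw [this]
      rfl
  | succ n ih =>
    have : Fintype ((i : Finset.Iic n) → Q) := Fintype.ofFinite _
    have hm : IsMarkovKernel ((G.stepKernel σ π n).map
        (MeasurableEquiv.piSingleton (X := fun _ => Q) n)) :=
      Kernel.IsMarkovKernel.map _ (MeasurableEquiv.piSingleton (X := fun _ => Q) n).measurable
    have hA : MeasurableSet (IicProdIoc (X := fun _ => Q) n (n + 1) ⁻¹' {h}) :=
      measurable_IicProdIoc (X := fun _ => Q) (measurableSet_singleton _)
    rw [Kernel.partialTraj_succ_of_le (Nat.zero_le n), Kernel.map_apply' _ (by fun_prop) _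
      (measurableSet_singleton _), Kernel.comp_apply' _ _ _ hA, lintegral_fintype, pastStates_succ, G.possible_snoc_iff, ← ih]
    simp only [ne_eq, Finset.sum_eq_zero_iff, Finset.mem_univ, true_imp_iff, mul_eq_zero, not_forall,
      not_or]
    -- One more round charges `h` only from its own restriction, and then exactly when its last
    -- state is a possible successor.
    have key : ∀ x : (i : Finset.Iic n) → Q,
        (Kernel.id ×ₖ (G.stepKernel σ π n).map (MeasurableEquiv.piSingleton (X := fun _ => Q) n)) x
          (IicProdIoc (X := fun _ => Q) n (n + 1) ⁻¹' {h}) ≠ 0 ↔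
        x = Preorder.frestrictLe₂ (π := fun _ => Q) n.le_succ h ∧
          currentState h ∈ (G.nextState σ π (pastStates x) (currentState x)).support := by
      intro x
      rw [Kernel.id_prod_apply' _ _ hA,
        Kernel.map_apply' _ (MeasurableEquiv.piSingleton (X := fun _ => Q) n).measurable _
        (measurable_prodMk_left hA)]
      change (G.nextState σ π (pastStates x) (currentState x)).toMeasure _ ≠ 0 ↔ _
      rw [ne_eq, PMF.toMeasure_apply_eq_zero_iff _ (Set.toFinite _).measurableSet,
        Set.not_disjoint_iff]
      constructor
      · rintro ⟨y, hy, hy2⟩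
        have hy3 : IicProdIoc (X := fun _ => Q) n (n + 1)
          (x, MeasurableEquiv.piSingleton (X := fun _ => Q) n y) = h := hy2
        subst hy3
        refine ⟨?_, ?_⟩
        · exact (congrFun (frestrictLe₂_comp_IicProdIoc (X := fun _ => Q) n.le_succ)
            (x, MeasurableEquiv.piSingleton (X := fun _ => Q) n y)).symm
        · convert hy
          simp [currentState, IicProdIoc, MeasurableEquiv.piSingleton]
      · rintro ⟨rfl, hy⟩
        refine ⟨_, hy, ?_⟩
        change IicProdIoc (X := fun _ => Q) n (n + 1) (_, _) = h
        funext i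
        by_cases hi : (i : ℕ) ≤ n
        · simp [IicProdIoc, hi]
        · have : i = ⟨n + 1, Finset.mem_Iic.2 le_rfl⟩ := by
            ext
            have := Finset.mem_Iic.1 i.2
            change (i : ℕ) = n + 1
            lia
          subst this
          simp [IicProdIoc, MeasurableEquiv.piSingleton, currentState]
    constructor
    · rintro ⟨x, hx1, hx2⟩
      obtain ⟨rfl, h2⟩ := (key x).1 hx1
      exact ⟨hx2, h2⟩
    · rintro ⟨h1, h2⟩
      exact ⟨_, (key _).2 ⟨rfl, h2⟩, h1⟩

lemma Game.playMeasure_reach_ne_zero_iff (G : Game Q A₁ A₂) (q₀ : Q) (σ : PureStrategy Q A₁)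
    (π : RandStrategy Q A₂) (T : Set Q) :
    G.playMeasure q₀ σ π (Reach T) ≠ 0 ↔ ∃ ρ q, G.Possible q₀ σ π ρ q ∧ q ∈ T := by
  -- Reachability is a countable union of events, each a finite union of cylinders, so it is null
  -- iff every such cylinder is.
  have h1 : Reach T = ⋃ n : ℕ, (Preorder.frestrictLe (π := fun _ => Q) n) ⁻¹'
      (⋃ h ∈ {h : (i : Finset.Iic n) → Q | currentState h ∈ T}, {h}) := by
    ext x
    simp [Reach, currentState]
  rw [h1, ne_eq, measure_iUnion_null_iff, not_forall]
  have h2 : ∀ n : ℕ, G.playMeasure q₀ σ π ((Preorder.frestrictLe (π := fun _ => Q) n) ⁻¹'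
      (⋃ h ∈ {h : (i : Finset.Iic n) → Q | currentState h ∈ T}, {h})) =
      Kernel.partialTraj (X := fun _ => Q) (fun n => G.stepKernel σ π n) 0 n (fun _ => q₀)
        (⋃ h ∈ {h : (i : Finset.Iic n) → Q | currentState h ∈ T}, {h}) := by
    intro n
    rw [← Kernel.traj_map_frestrictLe_apply, Measure.map_apply (by fun_prop)
      (Set.toFinite _).measurableSet]
    rfl
  simp only [h2, measure_biUnion_null_iff (Set.to_countable _), not_forall]
  constructor
  · rintro ⟨n, h, hT, hh⟩
    exact ⟨_, _, (G.partialTraj_singleton_ne_zero_iff q₀ σ π n h).1 hh, hT⟩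
  · rintro ⟨ρ, q, hp, hT⟩
    obtain ⟨h, rfl', rfl⟩ := exists_pastStates_eq ρ q
    refine ⟨ρ.length, h, hT, (G.partialTraj_singleton_ne_zero_iff q₀ σ π _ h).2 ?_⟩
    rwa [rfl']

end PlayMeasure

section Prob

variable {Q A₁ A₂ : Type*} [Finite Q]

lemma Game.prob_reach_pos_iff (G : Game Q A₁ A₂) (q₀ : Q) (σ : PureStrategy Q A₁)
    (π : RandStrategy Q A₂) (T : Set Q) :
    0 < G.prob q₀ σ π (Reach T) ↔ ∃ ρ q, G.Possible q₀ σ π ρ q ∧ q ∈ T := by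
  let _ : MeasurableSpace Q := ⊤
  have : MeasurableSingletonClass Q := ⟨fun _ => trivial⟩
  rw [pos_iff_ne_zero]
  exact G.playMeasure_reach_ne_zero_iff q₀ σ π T

lemma Game.prob_safe_eq_one_iff (G : Game Q A₁ A₂) (q₀ : Q) (σ : PureStrategy Q A₁)
    (π : RandStrategy Q A₂) (S : Set Q) :
    G.prob q₀ σ π (Safe S) = 1 ↔ ∀ ρ q, G.Possible q₀ σ π ρ q → q ∈ S := by
  let _ : MeasurableSpace Q := ⊤
  have : MeasurableSingletonClass Q := ⟨fun _ => trivial⟩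
  have hp : IsProbabilityMeasure (G.playMeasure q₀ σ π) := by
    unfold Game.playMeasure
    infer_instance
  have hc : Reach Sᶜ = (Safe S)ᶜ := by
    ext x
    simp [Reach, Safe]
  have hm : MeasurableSet (Safe S) := by
    have : Safe S = ⋂ i : ℕ, (fun x : ℕ → Q => x i) ⁻¹' S := by
      ext x
      simp [Safe]
    rw [this]
    exact MeasurableSet.iInter fun i => measurable_pi_apply i trivial
  change G.playMeasure q₀ σ π (Safe S) = 1 ↔ _
  rw [← prob_compl_eq_zero_iff hm, ← hc, ← not_iff_not, ← ne_eq,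
    G.playMeasure_reach_ne_zero_iff q₀ σ π]
  simp

end Prob

/-! ### Deterministic opponents and compactness -/

section PureResponse

variable {Q A₁ A₂ : Type*}

/-- The deterministic strategy of player 2 that answers the observation sequence `w` by `f w`. -/
noncomputable def pureResponse (s : Setoid Q) (f : List (Obs s) → A₂) : RandStrategy Q A₂ :=
  fun ρ q => PMF.pure (f ((ρ ++ [q]).map (obs s)))

lemma observationBased_pureResponse (s : Setoid Q) (f : List (Obs s) → A₂) :
    ObservationBased s (pureResponse s f) := by
  intro ρ ρ' q q' h h'
  simp only [pureResponse, List.map_append, h, List.map_cons, h', List.map_nil]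

lemma Game.mem_support_nextState_pureResponse (G : Game Q A₁ A₂) {σ : PureStrategy Q A₁}
    {f : List (Obs G.obs₂) → A₂} {ρ : List Q} {q q' : Q} :
    q' ∈ (G.nextState σ (pureResponse G.obs₂ f) ρ q).support ↔
      q' ∈ (G.trans q (σ ρ q) (f ((ρ ++ [q]).map (obs G.obs₂)))).support := by
  simp [G.mem_support_nextState, pureResponse]

lemma Game.Possible.mono {G : Game Q A₁ A₂} {q₀ : Q} {σ : PureStrategy Q A₁}
    {π π' : RandStrategy Q A₂} (h : ∀ ρ q, (π ρ q).support ⊆ (π' ρ q).support) {ρ : List Q} {q : Q}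
    (hp : G.Possible q₀ σ π ρ q) : G.Possible q₀ σ π' ρ q := by
  induction hp with
  | nil => exact .nil
  | snoc _ h2 ih =>
    rw [G.mem_support_nextState] at h2
    obtain ⟨b, hb, hq⟩ := h2
    exact .snoc ih (G.mem_support_nextState.2 ⟨b, h _ _ hb, hq⟩)

lemma Game.Possible.congr {G : Game Q A₁ A₂} {q₀ : Q} {σ σ' : PureStrategy Q A₁}
    {π : RandStrategy Q A₂} {ρ : List Q} {q : Q} (hp : G.Possible q₀ σ π ρ q)
    (h : ∀ τ r, τ.length < ρ.length → σ τ r = σ' τ r) : G.Possible q₀ σ' π ρ q := by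
  induction hp with
  | nil => exact .nil
  | snoc _ h2 ih =>
    refine .snoc (ih fun τ r hl => h τ r ?_) ?_
    · simp only [List.length_append, List.length_singleton]
      lia
    · rw [G.mem_support_nextState] at h2 ⊢
      rwa [← h _ _ (by simp)]

/-- Choosing one action from each support is consistent because the support depends on the
observations alone. -/
lemma exists_pureResponse_support_subset {s : Setoid Q} {π : RandStrategy Q A₂} (q₀ : Q)
    (hπ : ObservationBased s π) :
    ∃ f : List (Obs s) → A₂, ∀ ρ q, (pureResponse s f ρ q).support ⊆ (π ρ q).support := by
  have h : ∀ l : List (Obs s), ∃ a, ∀ ρ q, (ρ ++ [q]).map (obs s) = l → a ∈ (π ρ q).support := by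
    intro l
    by_cases hl : ∃ ρ q, (ρ ++ [q]).map (obs s) = l
    · obtain ⟨ρ, q, rfl⟩ := hl
      obtain ⟨a, ha⟩ := (π ρ q).support_nonempty
      refine ⟨a, fun ρ' q' h => ?_⟩
      rw [List.map_append, List.map_append] at h
      obtain ⟨h1, h2⟩ := List.append_inj' h rfl
      rwa [hπ ρ' ρ q' q h1 (by simpa using h2)]
    · obtain ⟨a, -⟩ := (π [] q₀).support_nonempty
      exact ⟨a, fun ρ q h => absurd ⟨ρ, q, h⟩ hl⟩
  choose f hf using h
  refine ⟨f, fun ρ q => ?_⟩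
  simp only [pureResponse, PMF.support_pure, Set.singleton_subset_iff]
  exact hf _ _ _ rfl

/-- Shrinking the supports of player 2's choices only removes possible prefixes, so deterministic
opponents are the hardest. -/
lemma Game.positiveWinning_reach_iff [Finite Q] (G : Game Q A₁ A₂) (q₀ : Q)
    (σ : PureStrategy Q A₁) (T : Set Q) :
    G.PositiveWinning q₀ σ (Reach T) ↔ ∀ f : List (Obs G.obs₂) → A₂,
      ∃ ρ q, G.Possible q₀ σ (pureResponse G.obs₂ f) ρ q ∧ q ∈ T := by
  constructor
  · intro h f
    exact (G.prob_reach_pos_iff _ _ _ _).1 (h _ (observationBased_pureResponse _ f))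
  · intro h π hπ
    rw [G.prob_reach_pos_iff]
    obtain ⟨f, hf⟩ := exists_pureResponse_support_subset q₀ hπ
    obtain ⟨ρ, q, hp, hq⟩ := h f
    exact ⟨ρ, q, hp.mono hf, hq⟩

/-- By compactness, a positive winning strategy for reachability reaches the target within a bounded
number of rounds. -/
lemma Game.exists_bound_of_positiveWinning_reach [Finite Q] [Finite A₂] (G : Game Q A₁ A₂) {q₀ : Q}
    {σ : PureStrategy Q A₁} {T : Set Q} (h : G.PositiveWinning q₀ σ (Reach T)) :
    ∃ N : ℕ, ∀ f : List (Obs G.obs₂) → A₂,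
      ∃ ρ q, G.Possible q₀ σ (pureResponse G.obs₂ f) ρ q ∧ q ∈ T ∧ ρ.length ≤ N := by
  let _ : TopologicalSpace A₂ := ⊥
  have : DiscreteTopology A₂ := ⟨rfl⟩
  rw [G.positiveWinning_reach_iff] at h
  let U : List Q × Q → Set (List (Obs G.obs₂) → A₂) := fun x =>
    {f | G.Possible q₀ σ (pureResponse G.obs₂ f) x.1 x.2 ∧ x.2 ∈ T}
  -- The possibility of a fixed prefix depends on finitely many values of `f`.
  have hopen : ∀ ρ q, IsOpen {f | G.Possible q₀ σ (pureResponse G.obs₂ f) ρ q} := by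
    intro ρ
    induction ρ using List.reverseRecOn with
    | nil =>
      intro q
      simp only [G.possible_nil_iff]
      exact isOpen_const
    | append_singleton ρ p ih =>
      intro q
      simp only [G.possible_snoc_iff, G.mem_support_nextState_pureResponse]
      refine (ih p).inter ?_
      have hc : Continuous fun f : List (Obs G.obs₂) → A₂ => f ((ρ ++ [p]).map (obs G.obs₂)) :=
        continuous_apply _
      exact (isOpen_discrete {a | q ∈ (G.trans p (σ ρ p) a).support}).preimage hc
  have hU : ∀ x, IsOpen (U x) := fun x => (hopen x.1 x.2).and isOpen_const
  obtain ⟨t, ht⟩ := isCompact_univ.elim_finite_subcover U hU fun f _ => by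
    obtain ⟨ρ, q, hp⟩ := h f
    exact Set.mem_iUnion.2 ⟨(ρ, q), hp⟩
  refine ⟨t.sup fun x => x.1.length, fun f => ?_⟩
  obtain ⟨x, hx, hf⟩ := Set.mem_iUnion₂.1 (ht (Set.mem_univ f))
  exact ⟨x.1, x.2, hf.1, hf.2, Finset.le_sup (f := fun x : List Q × Q => x.1.length) hx⟩

end PureResponse

/-! ### Finite memory suffices -/

section FiniteMemory

variable {Q A₁ A₂ : Type*}

lemma Transducer.observationBased_strategy {s : Setoid Q} {A Mem : Type*}
    (τ : Transducer (Obs s) A Mem) : ObservationBased s τ.strategy := by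
  intro ρ ρ' q q' h h'
  simp only [Transducer.strategy, h, h']

/-- The memory is transported to `Fin n`, since `FiniteMemory` asks for a memory in the lowest
universe. -/
lemma Transducer.finiteMemory_strategy {s : Setoid Q} {A Mem : Type*} [Finite Mem]
    (τ : Transducer (Obs s) A Mem) : FiniteMemory s τ.strategy := by
  obtain ⟨n, ⟨e⟩⟩ := Finite.exists_equiv_fin Mem
  refine ⟨Fin n, inferInstance, ⟨e τ.init, fun m o => e (τ.update (e.symm m) o),
    fun m o => τ.next (e.symm m) o⟩, ?_⟩
  funext ρ q
  have : ∀ (l : List (Obs s)) (m : Mem),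
      l.foldl (fun m o => e (τ.update (e.symm m) o)) (e m) = e (l.foldl τ.update m) := by
    intro l
    induction l with
    | nil => intro m; rfl
    | cons o l ih =>
      intro m
      simp only [List.foldl_cons, Equiv.symm_apply_apply, ih]
  simp only [Transducer.strategy, this, Equiv.symm_apply_apply]

/-- The states in which player 1, playing `σ`, may be after having seen the observations `w`
(those of the earlier states, excluding the current one). -/
def Game.belief [Fintype A₂] [Nonempty A₂] (G : Game Q A₁ A₂) (q₀ : Q) (σ : PureStrategy Q A₁)
    (w : List (Obs G.obs₁)) : Set Q :=
  {q | ∃ ρ, G.Possible q₀ σ (fun _ _ => PMF.uniformOfFintype A₂) ρ q ∧ ρ.map (obs G.obs₁) = w}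

/-- Normalization of observation sequences: short sequences are kept, and long ones are replaced by
a chosen sequence with the same belief. -/
noncomputable def Game.normalize [Fintype A₂] [Nonempty A₂] (G : Game Q A₁ A₂) (q₀ : Q)
    (σ : PureStrategy Q A₁) (N : ℕ) (w : List (Obs G.obs₁)) : List (Obs G.obs₁) :=
  if w.length ≤ N then w else Function.invFun (G.belief q₀ σ) (G.belief q₀ σ w)

lemma Game.belief_normalize [Fintype A₂] [Nonempty A₂] (G : Game Q A₁ A₂) (q₀ : Q)
    (σ : PureStrategy Q A₁) (N : ℕ) (w : List (Obs G.obs₁)) :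
    G.belief q₀ σ (G.normalize q₀ σ N w) = G.belief q₀ σ w := by
  unfold Game.normalize
  split_ifs
  · rfl
  · exact Function.invFun_eq ⟨w, rfl⟩

lemma Game.finite_range_normalize [Finite Q] [Fintype A₂] [Nonempty A₂] (G : Game Q A₁ A₂) (q₀ : Q)
    (σ : PureStrategy Q A₁) (N : ℕ) : (Set.range (G.normalize q₀ σ N)).Finite := by
  refine ((List.finite_length_le (Obs G.obs₁) N).union
    (Set.finite_range (Function.invFun (G.belief q₀ σ)))).subset ?_
  rintro _ ⟨w, rfl⟩
  unfold Game.normalize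
  split_ifs with h
  · exact Or.inl h
  · exact Or.inr ⟨_, rfl⟩

/-- The transducer whose memory consists of normalized observation sequences and that imitates
`σ`. -/
noncomputable def Game.normalizedTransducer [Fintype A₂] [Nonempty A₂] (G : Game Q A₁ A₂) (q₀ : Q)
    (σ : Rule (Obs G.obs₁) A₁) (σ' : PureStrategy Q A₁) (N : ℕ) :
    Transducer (Obs G.obs₁) A₁ (Set.range (G.normalize q₀ σ' N)) where
  init := ⟨_, [], rfl⟩
  update w o := ⟨_, w.1 ++ [o], rfl⟩
  next w o := σ w.1 o

lemma ObservationBased.exists_rule {s : Setoid Q} {C : Type*} {σ : Rule Q C}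
    (h : ObservationBased s σ) :
    ∃ σ' : Rule (Obs s) C, ∀ ρ q, σ ρ q = σ' (ρ.map (obs s)) (obs s q) := by
  refine ⟨fun w o => σ (w.map Quotient.out) o.out, fun ρ q => h _ _ _ _ ?_ ?_⟩
  · rw [List.map_map, List.map_map]
    exact List.map_congr_left fun x _ => (Quotient.out_eq _).symm
  · exact (Quotient.out_eq _).symm

lemma Game.exists_finiteMemory [Finite Q] [Finite A₂] (G : Game Q A₁ A₂) (q₀ : Q) (T S : Set Q)
    {σ : PureStrategy Q A₁} (hσ : ObservationBased G.obs₁ σ)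
    (hT : G.PositiveWinning q₀ σ (Reach T)) (hS : G.AlmostSureWinning q₀ σ (Safe S)) :
    ∃ σ' : PureStrategy Q A₁, ObservationBased G.obs₁ σ' ∧ FiniteMemory G.obs₁ σ' ∧
      G.PositiveWinning q₀ σ' (Reach T) ∧ G.AlmostSureWinning q₀ σ' (Safe S) := by
  have : Fintype A₂ := Fintype.ofFinite A₂
  obtain ⟨σ₀, hσ₀⟩ := hσ.exists_rule
  -- Without actions player 2 has no strategy at all, and both winning conditions are vacuous.
  rcases isEmpty_or_nonempty A₂ with hA | hA
  · have hempty : ∀ π : RandStrategy Q A₂, False := fun π =>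
      hA.elim (π [] q₀).support_nonempty.some
    let τ : Transducer (Obs G.obs₁) A₁ Unit := ⟨(), fun _ _ => (), fun _ o => σ [] o.out⟩
    exact ⟨τ.strategy, τ.observationBased_strategy, τ.finiteMemory_strategy,
      fun π => (hempty π).elim, fun π => (hempty π).elim⟩
  obtain ⟨N, hN⟩ := G.exists_bound_of_positiveWinning_reach hT
  have hfin : Finite (Set.range (G.normalize q₀ σ N)) := G.finite_range_normalize q₀ σ N
  let τ := G.normalizedTransducer q₀ σ₀ σ N
  let mem : List (Obs G.obs₁) → List (Obs G.obs₁) := fun w => (w.foldl τ.update τ.init).1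
  have hmem_nil : mem [] = G.normalize q₀ σ N [] := rfl
  have hmem_snoc : ∀ w o, mem (w ++ [o]) = G.normalize q₀ σ N (mem w ++ [o]) := by
    intro w o
    simp only [mem, List.foldl_append, List.foldl_cons, List.foldl_nil]
    rfl
  have hτ : ∀ ρ q, τ.strategy ρ q = σ₀ (mem (ρ.map (obs G.obs₁))) (obs G.obs₁ q) := fun _ _ => rfl
  have hshort : ∀ w : List (Obs G.obs₁), w.length ≤ N → mem w = w := by
    intro w
    induction w using List.reverseRecOn with
    | nil =>
      intro h
      rw [hmem_nil, Game.normalize, if_pos h]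
    | append_singleton w o ih =>
      intro h
      have h' := h
      rw [List.length_append] at h'
      rw [hmem_snoc, ih (by lia), Game.normalize, if_pos h]
  -- The uniform strategy of player 2 makes every action possible, so safety against it confines all
  -- beliefs.
  have hbelief : ∀ w, G.belief q₀ σ w ⊆ S := by
    rintro w q ⟨ρ, hp, -⟩
    exact (G.prob_safe_eq_one_iff q₀ σ _ S).1 (hS _ fun _ _ _ _ _ _ => rfl) ρ q hp
  -- The transducer plays as `σ` would after the stored word. The current state is also reached by
  -- some `σ`-prefix with that word as its past observations, and that prefix can be extended by the
  -- same move.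
  have hinv : ∀ (π : RandStrategy Q A₂) ρ q, G.Possible q₀ τ.strategy π ρ q →
      q ∈ G.belief q₀ σ (mem (ρ.map (obs G.obs₁))) := by
    intro π ρ q hp
    induction hp with
    | nil =>
      rw [List.map_nil, hmem_nil, G.belief_normalize]
      exact ⟨[], .nil, rfl⟩
    | @snoc ρ q q' hp h2 ih =>
      rw [List.map_append, List.map_singleton, hmem_snoc, G.belief_normalize]
      obtain ⟨ρ', hp', hw⟩ := ih
      obtain ⟨b, -, hb⟩ := G.mem_support_nextState.1 h2
      refine ⟨ρ' ++ [q], .snoc hp' (G.mem_support_nextState.2 ⟨b, by simp, ?_⟩), by simp [hw]⟩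
      rwa [hσ₀, hw, ← hτ]
  refine ⟨τ.strategy, τ.observationBased_strategy, τ.finiteMemory_strategy, ?_, ?_⟩
  · rw [G.positiveWinning_reach_iff]
    intro f
    obtain ⟨ρ, q, hp, hq, hl⟩ := hN f
    refine ⟨ρ, q, hp.congr fun ρ' r hr => ?_, hq⟩
    rw [hσ₀, hτ, hshort _ (by rw [List.length_map]; lia)]
  · intro π _
    rw [G.prob_safe_eq_one_iff]
    exact fun ρ q hp => hbelief _ (hinv π ρ q hp)

lemma Game.almostSureWinning_safe_univ [Finite Q] (G : Game Q A₁ A₂) (q₀ : Q)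
    (σ : PureStrategy Q A₁) : G.AlmostSureWinning q₀ σ (Safe Set.univ) := by
  intro π _
  rw [G.prob_safe_eq_one_iff]
  exact fun _ _ _ => Set.mem_univ _

end FiniteMemory

/-! ### Spoiling strategies from invariants of token sets -/

section Spoiling

variable {Q A₁ A₂ : Type*}

/-- The play prefixes obtained from those in `X` by one more round in which player 1 plays `σ`,
player 2 plays `b`, and player 2 then observes `o`. -/
noncomputable def Game.step [Fintype Q] (G : Game Q A₁ A₂) (σ : PureStrategy Q A₁) (b : A₂)
    (o : Obs G.obs₂) (X : Finset (List Q × Q)) : Finset (List Q × Q) :=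
  open Classical in
  ((X.image fun x => x.1 ++ [x.2]) ×ˢ Finset.univ).filter fun y =>
    ∃ x ∈ X, y.1 = x.1 ++ [x.2] ∧ y.2 ∈ (G.trans x.2 (σ x.1 x.2) b).support ∧ obs G.obs₂ y.2 = o

lemma Game.mem_step [Fintype Q] (G : Game Q A₁ A₂) {σ : PureStrategy Q A₁} {b : A₂}
    {o : Obs G.obs₂} {X : Finset (List Q × Q)} {y : List Q × Q} :
    y ∈ G.step σ b o X ↔ ∃ x ∈ X, y.1 = x.1 ++ [x.2] ∧
      y.2 ∈ (G.trans x.2 (σ x.1 x.2) b).support ∧ obs G.obs₂ y.2 = o := by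
  classical
  simp only [Game.step, Finset.mem_filter, Finset.mem_product, Finset.mem_image, Finset.mem_univ,
    and_true, and_iff_right_iff_imp]
  rintro ⟨x, hx, h, -⟩
  exact ⟨x, hx, h.symm⟩

/-- If player 2 can preserve an invariant of the set of play prefixes that are compatible with what
he has seen, and the invariant excludes the target, then player 1 is not positive winning. -/
lemma Game.not_positiveWinning_of_invariant [Fintype Q] (G : Game Q A₁ A₂) {q₀ : Q}
    {σ : PureStrategy Q A₁} {T : Set Q} (Inv : Finset (List Q × Q) → Prop) (h₀ : Inv {([], q₀)})
    (hstep : ∀ X, Inv X → ∃ b, ∀ o, Inv (G.step σ b o X))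
    (hT : ∀ X, Inv X → ∀ x ∈ X, x.2 ∉ T) : ¬ G.PositiveWinning q₀ σ (Reach T) := by
  have hb : ∀ X, ∃ b, Inv X → ∀ o, Inv (G.step σ b o X) := by
    intro X
    by_cases hX : Inv X
    · obtain ⟨b, hb⟩ := hstep X hX
      exact ⟨b, fun _ => hb⟩
    · obtain ⟨b, -⟩ := hstep _ h₀
      exact ⟨b, fun h => absurd h hX⟩
  choose b hb using hb
  let tok : List (Obs G.obs₂) → Finset (List Q × Q) := fun w =>
    w.foldl (fun X o => G.step σ (b X) o X) {([], q₀)}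
  have htok : ∀ w, Inv (tok w) := by
    intro w
    induction w using List.reverseRecOn with
    | nil => exact h₀
    | append_singleton w o ih =>
      simp only [tok, List.foldl_append, List.foldl_cons, List.foldl_nil]
      exact hb _ ih o
  rw [G.positiveWinning_reach_iff]
  intro h
  -- The tail drops the observation of the initial state, which is already accounted for by the
  -- starting set.
  obtain ⟨ρ, q, hp, hq⟩ := h fun w => b (tok w.tail)
  have hmem : (ρ, q) ∈ tok ((ρ ++ [q]).map (obs G.obs₂)).tail := by
    clear hq
    induction hp with
    | nil => simp [tok]
    | @snoc ρ q q' _ h2 ih =>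
      rw [G.mem_support_nextState_pureResponse] at h2
      rw [List.map_append (l₁ := ρ ++ [q]), List.tail_append_of_ne_nil (by simp)]
      simp only [tok, List.foldl_append, List.foldl_cons, List.foldl_nil, List.map_singleton]
      exact G.mem_step.2 ⟨(ρ, q), ih, rfl, h2, rfl⟩
  exact hT _ (htok _) _ hmem hq

end Spoiling

/-- Under a constant observation the memory is an iterated map. A repetition up to time `t` would
make the memory of time `t` occur earlier, and with it the output `a`. -/
lemma Transducer.lt_card_of_first {Q A Mem : Type*} [Finite Mem] {s : Setoid Q}
    (τ : Transducer (Obs s) A Mem) (q : Q) (a : A) (t : ℕ)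
    (ht : τ.strategy (List.replicate t q) q = a)
    (hlt : ∀ i < t, τ.strategy (List.replicate i q) q ≠ a) : t < Nat.card Mem := by
  let m : ℕ → Mem := fun i => (fun x => τ.update x (obs s q))^[i] τ.init
  have hm : ∀ i, τ.strategy (List.replicate i q) q = τ.next (m i) (obs s q) := by
    intro i
    have : ∀ (i : ℕ) (x : Mem), (List.replicate i (obs s q)).foldl τ.update x =
        (fun x => τ.update x (obs s q))^[i] x := by
      intro i
      induction i with
      | zero => intro x; rfl
      | succ i ih =>
        intro x
        rw [List.replicate_succ, List.foldl_cons, ih, Function.iterate_succ_apply]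
    simp only [Transducer.strategy, List.map_replicate, this, m]
  simp only [hm] at ht hlt
  by_contra hc
  have hnot : ¬ Function.Injective fun i : Fin (t + 1) => m i := by
    intro hinj
    have := Nat.card_le_card_of_injective _ hinj
    rw [Nat.card_eq_fintype_card, Fintype.card_fin] at this
    lia
  simp only [Function.Injective, not_forall] at hnot
  obtain ⟨i, j, hij, hne⟩ := hnot
  have key : ∀ i j : ℕ, i < j → j ≤ t → m i = m j → False := by
    intro i j hij hj h
    have h2 : m (i + (t - j)) = m t := by
      have h3 : m (t - j + i) = m (t - j + j) := by
        simp only [m, Function.iterate_add_apply]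
        exact congrArg _ h
      rwa [Nat.sub_add_cancel hj, Nat.add_comm] at h3
    exact hlt (i + (t - j)) (by lia) (by rw [h2, ht])
  rcases lt_or_gt_of_ne (fun h => hne (Fin.ext h) : (i : ℕ) ≠ j) with h | h
  · exact key i j h (by lia) hij
  · exact key j i h (by lia) hij.symm

/-! ### The tower game -/

/-- The three kinds of tokens in the tower game. -/
inductive Kind
  | source
  | active
  | waiting
  deriving DecidableEq

instance : Fintype Kind := ⟨{.source, .active, .waiting}, fun k => by cases k <;> simp⟩

/-- States of the tower game: a phase, counting down from `K` to `0`, and a token kind. -/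
abbrev TowerState (K : ℕ) : Type := Fin (K + 1) × Kind

/-- The possible successors of a token in phase `i + 1`. The action `none` means to advance to the
next phase for player 1, and to challenge the active tokens for player 2; an action `some x` is a
bit. The state `(0, source)` is a sink. -/
def towerSuccs {K : ℕ} (i : Fin K) : Kind → Option Bool → Option Bool → Finset (TowerState K)
  | .source, a, b =>
    if b = none ∧ i.succ ≠ Fin.last K then {(0, .source)}
    else if a = none then {(i.castSucc, .source)} else {(i.succ, .source), (i.succ, .waiting)}
  | .waiting, a, b =>
    if b = none ∧ i.succ ≠ Fin.last K then {(0, .source)}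
    else if a = none then {(i.castSucc, .active)} else {(i.succ, .waiting)}
  | .active, a, b =>
    if b = none then {(0, .active)}
    else if a = b then {(i.succ, .active)} else {(0, .source)}

lemma towerSuccs_nonempty {K : ℕ} (i : Fin K) (k : Kind) (a b : Option Bool) :
    (towerSuccs i k a b).Nonempty := by
  cases k <;> simp only [towerSuccs] <;> split_ifs <;> simp

/-- The tower game: player 1 has perfect information, and player 2 sees the phase only. In every
phase, the source emits at most one waiting token per round, while player 2 removes half of the
active tokens in every round, and challenges as soon as there are none. The waiting tokens of a phase
are the active tokens of the next one. Player 1 has to bring an active token to phase `0`. -/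
noncomputable def towerGame (K : ℕ) : Game (TowerState K) (Option Bool) (Option Bool) where
  trans q a b := Fin.cases (motive := fun _ => PMF (TowerState K)) (PMF.pure (0, q.2))
    (fun i => PMF.uniformOfFinset (towerSuccs i q.2 a b) (towerSuccs_nonempty i q.2 a b)) q.1
  obs₁ := ⊥
  obs₂ := Setoid.ker Prod.fst

lemma mem_support_towerGame_trans_zero {K : ℕ} {k : Kind} {a b : Option Bool} {q : TowerState K} :
    q ∈ ((towerGame K).trans (0, k) a b).support ↔ q = (0, k) := by
  simp [towerGame]

lemma mem_support_towerGame_trans_succ {K : ℕ} {i : Fin K} {k : Kind} {a b : Option Bool}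
    {q : TowerState K} :
    q ∈ ((towerGame K).trans (i.succ, k) a b).support ↔ q ∈ towerSuccs i k a b := by
  simp [towerGame]

lemma obs_towerGame_eq_iff {K : ℕ} {q q' : TowerState K} :
    obs (towerGame K).obs₂ q = obs (towerGame K).obs₂ q' ↔ q.1 = q'.1 :=
  Quotient.eq (r := (towerGame K).obs₂)

/-- The target of the tower game. -/
def towerTarget (K : ℕ) : Set (TowerState K) := {(0, .active)}

/-! ### Leaving the first phase too early loses -/

section LowerBound

variable {K : ℕ}

/-- The number of tokens of a kind in a set of play prefixes. -/
def tokenCount (k : Kind) (X : Finset (List (TowerState K) × TowerState K)) : ℕ :=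
  (X.filter fun x => x.2.2 = k).card

/-- A token has at most one successor of kind `k` with observation `o`: the observation fixes the
phase, and phase and kind fix the state. -/
lemma tokenCount_step_le {σ : PureStrategy (TowerState K) (Option Bool)} {b : Option Bool}
    {o : Obs (towerGame K).obs₂} {X : Finset (List (TowerState K) × TowerState K)} {k : Kind}
    (P : List (TowerState K) × TowerState K → Prop) [DecidablePred P]
    (hP : ∀ x ∈ X, ∀ q ∈ ((towerGame K).trans x.2 (σ x.1 x.2) b).support,
      obs (towerGame K).obs₂ q = o → q.2 = k → P x) :
    tokenCount k ((towerGame K).step σ b o X) ≤ (X.filter P).card := by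
  rcases Finset.eq_empty_or_nonempty (((towerGame K).step σ b o X).filter fun x => x.2.2 = k)
    with h | ⟨y₀, hy₀⟩
  · rw [tokenCount, h]
    exact Nat.zero_le _
  · rw [Finset.mem_filter, Game.mem_step] at hy₀
    obtain ⟨⟨x₀, hx₀, -, -, ho₀⟩, hk₀⟩ := hy₀
    have hsub : (((towerGame K).step σ b o X).filter fun x => x.2.2 = k) ⊆
        (X.filter P).image fun x => (x.1 ++ [x.2], y₀.2) := by
      intro y hy
      rw [Finset.mem_filter, Game.mem_step] at hy
      obtain ⟨⟨x, hx, h1, h2, ho⟩, hk⟩ := hy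
      refine Finset.mem_image.2 ⟨x, Finset.mem_filter.2 ⟨hx, hP x hx _ h2 ho hk⟩, ?_⟩
      refine Prod.ext h1.symm (Prod.ext ?_ (hk₀.trans hk.symm))
      exact obs_towerGame_eq_iff.1 (ho₀.trans ho.symm)
    exact (Finset.card_le_card hsub).trans Finset.card_image_le

/-- The invariant that player 2 maintains in the tower game against `σ`. -/
def TowerInvariant (σ : PureStrategy (TowerState K) (Option Bool))
    (X : Finset (List (TowerState K) × TowerState K)) : Prop :=
  ((∀ x ∈ X, x.2.1 = 0) ∧ tokenCount .active X = 0) ∨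
  (∃ i : Fin K, i.succ ≠ Fin.last K ∧ (∀ x ∈ X, x.2.1 = i.succ) ∧ tokenCount .source X ≤ 1 ∧
    (2 ^ tokenCount .waiting X * tokenCount .active X < tower (i + 1) 1 ∨
      tokenCount .source X = 0 ∧ tokenCount .waiting X = 0)) ∨
  ((∀ x ∈ X, x.2.1 = Fin.last K) ∧ tokenCount .active X = 0 ∧ ∃ t, tokenCount .waiting X ≤ t ∧
    ∀ x ∈ X, x.2.2 = .source → x.1 = List.replicate t (Fin.last K, .source) ∧
      ∀ i < t, σ (List.replicate i (Fin.last K, .source)) (Fin.last K, .source) ≠ none)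

lemma mem_step_phase {σ : PureStrategy (TowerState K) (Option Bool)} {b : Option Bool}
    {q : TowerState K} {X : Finset (List (TowerState K) × TowerState K)} :
    ∀ y ∈ (towerGame K).step σ b (obs _ q) X, y.2.1 = q.1 := by
  intro y hy
  obtain ⟨x, hx, -, -, ho⟩ := (Game.mem_step _).1 hy
  exact obs_towerGame_eq_iff.1 ho

lemma tokenCount_step_eq_zero {σ : PureStrategy (TowerState K) (Option Bool)} {b : Option Bool}
    {o : Obs (towerGame K).obs₂} {X : Finset (List (TowerState K) × TowerState K)} {k : Kind}
    (hP : ∀ x ∈ X, ∀ q ∈ ((towerGame K).trans x.2 (σ x.1 x.2) b).support,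
      obs (towerGame K).obs₂ q = o → q.2 ≠ k) :
    tokenCount k ((towerGame K).step σ b o X) = 0 := by
  have := tokenCount_step_le (fun _ => False) hP
  simpa using this

lemma tokenCount_empty {k : Kind} :
    tokenCount k (∅ : Finset (List (TowerState K) × TowerState K)) = 0 := rfl

lemma towerSuccs_phase {i : Fin K} {k : Kind} {a b : Option Bool} {q : TowerState K}
    (h : q ∈ towerSuccs i k a b) : q.1 = 0 ∨ q.1 = i.castSucc ∨ q.1 = i.succ := by
  cases k <;> simp only [towerSuccs] at h <;> split_ifs at h <;> simp at h <;> aesop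

lemma towerSuccs_source {i : Fin K} {k : Kind} {a b : Option Bool} {q : TowerState K}
    (h : q ∈ towerSuccs i k a b) (hq : q.2 = .source) (h0 : q.1 ≠ 0) :
    k = .source ∧ (q.1 = i.castSucc ∧ a = none ∨ q.1 = i.succ ∧ a ≠ none) := by
  cases k <;> simp only [towerSuccs] at h <;> split_ifs at h <;> simp at h <;> aesop

lemma towerSuccs_waiting {i : Fin K} {k : Kind} {a b : Option Bool} {q : TowerState K}
    (h : q ∈ towerSuccs i k a b) (hq : q.2 = .waiting) :
    q.1 = i.succ ∧ (k = .waiting ∨ k = .source) := by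
  cases k <;> simp only [towerSuccs] at h <;> split_ifs at h <;> simp at h <;> aesop

lemma towerSuccs_active {i : Fin K} {k : Kind} {a : Option Bool} {y : Bool} {q : TowerState K}
    (h : q ∈ towerSuccs i k a (some y)) (hq : q.2 = .active) :
    q.1 = i.castSucc ∧ k = .waiting ∨ q.1 = i.succ ∧ k = .active ∧ a = some y := by
  cases k <;> simp only [towerSuccs] at h <;> split_ifs at h <;> simp at h <;> aesop

lemma towerSuccs_challenge {i : Fin K} {k : Kind} {a : Option Bool} {q : TowerState K}
    (h : q ∈ towerSuccs i k a none) (hi : i.succ ≠ Fin.last K) (hk : k ≠ .active) :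
    q = (0, .source) := by
  cases k <;> simp_all [towerSuccs]

lemma mem_towerSuccs_of_phase {i : Fin K} {σ : PureStrategy (TowerState K) (Option Bool)}
    {b : Option Bool} {X : Finset (List (TowerState K) × TowerState K)}
    (hX : ∀ x ∈ X, x.2.1 = i.succ) {x : List (TowerState K) × TowerState K} (hx : x ∈ X)
    {q : TowerState K} (hq : q ∈ ((towerGame K).trans x.2 (σ x.1 x.2) b).support) :
    q ∈ towerSuccs i x.2.2 (σ x.1 x.2) b := by
  have : x.2 = (i.succ, x.2.2) := Prod.ext (hX x hx) rfl
  generalize σ x.1 x.2 = a at hq ⊢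
  rw [this] at hq
  exact mem_support_towerGame_trans_succ.1 hq

lemma towerInvariant_empty {σ : PureStrategy (TowerState K) (Option Bool)} :
    TowerInvariant σ ∅ :=
  .inl ⟨by simp, tokenCount_empty⟩

lemma towerInvariant_step_zero {σ : PureStrategy (TowerState K) (Option Bool)} {b : Option Bool}
    {o : Obs (towerGame K).obs₂} {X : Finset (List (TowerState K) × TowerState K)}
    (hX : ∀ x ∈ X, x.2.1 = 0) (hA : tokenCount .active X = 0) :
    TowerInvariant σ ((towerGame K).step σ b o X) := by
  have h : ∀ x ∈ X, ∀ q ∈ ((towerGame K).trans x.2 (σ x.1 x.2) b).support, q = x.2 := by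
    intro x hx q hq
    have h0 : x.2 = (0, x.2.2) := Prod.ext (hX x hx) rfl
    rw [h0] at hq ⊢
    exact mem_support_towerGame_trans_zero.1 hq
  refine .inl ⟨?_, ?_⟩
  · intro y hy
    obtain ⟨x, hx, -, h2, -⟩ := (Game.mem_step _).1 hy
    rw [h x hx _ h2, hX x hx]
  · refine tokenCount_step_eq_zero fun x hx q hq _ hk => ?_
    rw [h x hx q hq] at hk
    rw [tokenCount, Finset.card_eq_zero, Finset.filter_eq_empty_iff] at hA
    exact hA hx hk

/-- An active token plays at most one of the two bits, so the less popular bit is played by at most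
half of them. -/
lemma exists_minority {σ : PureStrategy (TowerState K) (Option Bool)}
    (X : Finset (List (TowerState K) × TowerState K)) :
    ∃ y : Bool, 2 * (X.filter fun x => x.2.2 = .active ∧ σ x.1 x.2 = some y).card ≤
      tokenCount .active X := by
  have h : (X.filter fun x => x.2.2 = .active ∧ σ x.1 x.2 = some true).card +
      (X.filter fun x => x.2.2 = .active ∧ σ x.1 x.2 = some false).card ≤
      tokenCount .active X := by
    rw [← Finset.card_union_of_disjoint]
    · refine Finset.card_le_card fun x hx => ?_
      simp only [Finset.mem_union, Finset.mem_filter] at hx ⊢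
      tauto
    · rw [Finset.disjoint_filter]
      rintro x - ⟨-, h1⟩ ⟨-, h2⟩
      rw [h1] at h2
      simp at h2
  by_cases h' : (X.filter fun x => x.2.2 = .active ∧ σ x.1 x.2 = some true).card ≤
      (X.filter fun x => x.2.2 = .active ∧ σ x.1 x.2 = some false).card
  · exact ⟨true, by lia⟩
  · exact ⟨false, by lia⟩

lemma tokenCount_waiting_step_le {i : Fin K} {σ : PureStrategy (TowerState K) (Option Bool)}
    {b : Option Bool} {o : Obs (towerGame K).obs₂}
    {X : Finset (List (TowerState K) × TowerState K)} (hX : ∀ x ∈ X, x.2.1 = i.succ) :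
    tokenCount .waiting ((towerGame K).step σ b o X) ≤
      tokenCount .waiting X + tokenCount .source X := by
  refine (tokenCount_step_le (fun x => x.2.2 = .waiting ∨ x.2.2 = .source) ?_).trans ?_
  · exact fun x hx q hq _ hk => (towerSuccs_waiting (mem_towerSuccs_of_phase hX hx hq) hk).2
  · rw [Finset.filter_or]
    exact Finset.card_union_le _ _

lemma tokenCount_source_step_le {i : Fin K} {σ : PureStrategy (TowerState K) (Option Bool)}
    {b : Option Bool} {q₀ : TowerState K} (h0 : q₀.1 ≠ 0)
    {X : Finset (List (TowerState K) × TowerState K)} (hX : ∀ x ∈ X, x.2.1 = i.succ) :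
    tokenCount .source ((towerGame K).step σ b (obs _ q₀) X) ≤ tokenCount .source X := by
  refine tokenCount_step_le (fun x => x.2.2 = .source) ?_
  intro x hx q hq ho hk
  rw [obs_towerGame_eq_iff] at ho
  exact (towerSuccs_source (mem_towerSuccs_of_phase hX hx hq) hk (ho ▸ h0)).1

lemma tokenCount_active_step_le {i : Fin K} {σ : PureStrategy (TowerState K) (Option Bool)}
    {y : Bool} {q₀ : TowerState K} (h0 : q₀.1 ≠ i.succ)
    {X : Finset (List (TowerState K) × TowerState K)} (hX : ∀ x ∈ X, x.2.1 = i.succ) :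
    tokenCount .active ((towerGame K).step σ (some y) (obs _ q₀) X) ≤ tokenCount .waiting X := by
  refine tokenCount_step_le (fun x => x.2.2 = .waiting) ?_
  intro x hx q hq ho hk
  rw [obs_towerGame_eq_iff] at ho
  rcases towerSuccs_active (mem_towerSuccs_of_phase hX hx hq) hk with h | h
  · exact h.2
  · exact absurd (ho.symm.trans h.1) h0

lemma tokenCount_waiting_step_eq_zero {i : Fin K} {σ : PureStrategy (TowerState K) (Option Bool)}
    {b : Option Bool} {q₀ : TowerState K} (h0 : q₀.1 ≠ i.succ)
    {X : Finset (List (TowerState K) × TowerState K)} (hX : ∀ x ∈ X, x.2.1 = i.succ) :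
    tokenCount .waiting ((towerGame K).step σ b (obs _ q₀) X) = 0 := by
  refine tokenCount_step_eq_zero ?_
  intro x hx q hq ho hk
  rw [obs_towerGame_eq_iff] at ho
  exact h0 (ho.symm.trans (towerSuccs_waiting (mem_towerSuccs_of_phase hX hx hq) hk).1)

lemma step_phase_cases {i : Fin K} {σ : PureStrategy (TowerState K) (Option Bool)}
    {b : Option Bool} {q₀ : TowerState K}
    {X : Finset (List (TowerState K) × TowerState K)} (hX : ∀ x ∈ X, x.2.1 = i.succ) :
    (towerGame K).step σ b (obs _ q₀) X = ∅ ∨ q₀.1 = 0 ∨ q₀.1 ≠ 0 ∧ q₀.1 = i.castSucc ∨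
      q₀.1 = i.succ := by
  rcases Finset.eq_empty_or_nonempty ((towerGame K).step σ b (obs _ q₀) X) with h | ⟨y, hy⟩
  · exact .inl h
  · obtain ⟨x, hx, -, h2, ho⟩ := (Game.mem_step _).1 hy
    rw [obs_towerGame_eq_iff] at ho
    have := towerSuccs_phase (mem_towerSuccs_of_phase hX hx h2)
    rw [ho] at this
    tauto

/-- With no active token, player 2 challenges safely. Otherwise he answers the minority bit: the
active tokens are halved while at most one waiting token is added, so the potential `2 ^ waiting *
active` does not grow. As some token is active, fewer than `tower i 1` are waiting, which is the
bound needed on entering the next phase. If neither source nor waiting tokens remain, the number of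
active ones is irrelevant, since no new ones can arise. -/
lemma towerInvariant_step_succ {i : Fin K} {σ : PureStrategy (TowerState K) (Option Bool)}
    {X : Finset (List (TowerState K) × TowerState K)} (hi : i.succ ≠ Fin.last K)
    (hX : ∀ x ∈ X, x.2.1 = i.succ) (hS : tokenCount .source X ≤ 1)
    (hWA : 2 ^ tokenCount .waiting X * tokenCount .active X < tower (i + 1) 1 ∨
      tokenCount .source X = 0 ∧ tokenCount .waiting X = 0) :
    ∃ b, ∀ o, TowerInvariant σ ((towerGame K).step σ b o X) := by
  rcases Nat.eq_zero_or_pos (tokenCount .active X) with hA | hA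
  · refine ⟨none, fun o => .inl ⟨?_, ?_⟩⟩
    all_goals rw [tokenCount, Finset.card_eq_zero, Finset.filter_eq_empty_iff] at hA
    · intro y hy
      obtain ⟨x, hx, -, h2, -⟩ := (Game.mem_step _).1 hy
      rw [towerSuccs_challenge (mem_towerSuccs_of_phase hX hx h2) hi (hA hx)]
    · refine tokenCount_step_eq_zero fun x hx q hq _ => ?_
      rw [towerSuccs_challenge (mem_towerSuccs_of_phase hX hx hq) hi (hA hx)]
      simp
  obtain ⟨y, hy⟩ := exists_minority (σ := σ) X
  refine ⟨some y, fun o => ?_⟩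
  induction o using Quotient.inductionOn with | h q₀ => ?_
  have hWT : tokenCount .waiting X < tower i 1 ∨
      tokenCount .source X = 0 ∧ tokenCount .waiting X = 0 := by
    refine hWA.imp_left fun h => ?_
    have h1 : 2 ^ tokenCount .waiting X < 2 ^ tower i 1 :=
      (Nat.le_mul_of_pos_right _ hA).trans_lt h
    exact (Nat.pow_lt_pow_iff_right (by norm_num)).1 h1
  rcases step_phase_cases (σ := σ) (b := some y) (q₀ := q₀) hX with h | h | ⟨h0, h⟩ | h
  · change TowerInvariant σ ((towerGame K).step σ (some y) (obs _ q₀) X)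
    rw [h]
    exact towerInvariant_empty
  · refine .inl ⟨fun z hz => (mem_step_phase z hz).trans h, ?_⟩
    refine tokenCount_step_eq_zero ?_
    intro x hx q hq ho hk
    replace ho := obs_towerGame_eq_iff.1 ho
    rw [h] at ho
    rcases towerSuccs_active (mem_towerSuccs_of_phase hX hx hq) hk with h1 | h1
    · have hi0 : (i : ℕ) = 0 := by
        have := congrArg Fin.val (ho.symm.trans h1.1)
        simpa using this.symm
      have hW : tokenCount .waiting X = 0 := by
        rcases hWT with h2 | h2
        · rw [hi0] at h2
          exact Nat.lt_one_iff.1 h2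
        · exact h2.2
      rw [tokenCount, Finset.card_eq_zero, Finset.filter_eq_empty_iff] at hW
      exact hW hx h1.2
    · exact absurd (ho.symm.trans h1.1).symm (Fin.succ_ne_zero i)
  · obtain ⟨j, hj⟩ := Fin.exists_succ_eq.2 h0
    have hne : q₀.1 ≠ i.succ := by
      rw [h]
      exact (Fin.castSucc_lt_succ).ne
    have hji : (j : ℕ) + 1 = i := by
      have := congrArg Fin.val (hj.trans h)
      simpa using this
    refine .inr (.inl ⟨j, ?_, fun z hz => (mem_step_phase z hz).trans hj.symm,
      (tokenCount_source_step_le h0 hX).trans hS, ?_⟩)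
    · rw [hj, h]
      exact (Fin.castSucc_lt_last i).ne
    · have hW' := tokenCount_waiting_step_eq_zero (σ := σ) (b := some y) hne hX
      have hA' := tokenCount_active_step_le (σ := σ) (y := y) hne hX
      have hS' := tokenCount_source_step_le (σ := σ) (b := some y) h0 hX
      rcases hWT with h2 | h2
      · left
        rw [hW', pow_zero, one_mul, hji]
        exact hA'.trans_lt h2
      · right
        exact ⟨Nat.le_zero.1 (hS'.trans_eq h2.1), hW'⟩
  · have hS' := tokenCount_source_step_le (σ := σ) (b := some y) (q₀ := q₀)
      (h ▸ Fin.succ_ne_zero i) hX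
    have hW' := tokenCount_waiting_step_le (σ := σ) (b := some y) (o := obs _ q₀) hX
    have hA' : tokenCount .active ((towerGame K).step σ (some y) (obs _ q₀) X) ≤
        (X.filter fun x => x.2.2 = .active ∧ σ x.1 x.2 = some y).card := by
      refine tokenCount_step_le _ ?_
      intro x hx q hq ho hk
      rw [obs_towerGame_eq_iff, h] at ho
      rcases towerSuccs_active (mem_towerSuccs_of_phase hX hx hq) hk with h1 | h1
      · exact absurd (h1.1.symm.trans ho) (Fin.castSucc_lt_succ).ne
      · exact h1.2
    refine .inr (.inl ⟨i, hi, fun z hz => (mem_step_phase z hz).trans h, hS'.trans hS, ?_⟩)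
    rcases hWA with h2 | h2
    · left
      refine lt_of_le_of_lt ?_ h2
      calc _ ≤ 2 ^ (tokenCount .waiting X + 1) * _ :=
            Nat.mul_le_mul_right _ (Nat.pow_le_pow_right (by norm_num) (hW'.trans (by lia)))
        _ = 2 ^ tokenCount .waiting X * (2 * _) := by rw [pow_succ, mul_assoc]
        _ ≤ _ := Nat.mul_le_mul_left _ ((Nat.mul_le_mul_left 2 hA').trans hy)
    · right
      exact ⟨by simpa using hS'.trans_eq h2.1, by simpa [h2.1, h2.2] using hW'⟩

/-- In the first phase player 2 just watches: there are at most as many waiting tokens as rounds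
played. Only an advance of the source itself must come early; if waiting tokens advance without it,
the next phase has no supply and player 2 wears them down. -/
lemma towerInvariant_step_last {i : Fin K} {σ : PureStrategy (TowerState K) (Option Bool)}
    (hσ : ∀ t, σ (List.replicate t (Fin.last K, .source)) (Fin.last K, .source) = none →
      (∀ j < t, σ (List.replicate j (Fin.last K, .source)) (Fin.last K, .source) ≠ none) →
        t < tower i 1)
    {X : Finset (List (TowerState K) × TowerState K)} (hi : i.succ = Fin.last K)
    (hi0 : (i : ℕ) ≠ 0) (hX : ∀ x ∈ X, x.2.1 = i.succ) (hA : tokenCount .active X = 0)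
    {t : ℕ} (hW : tokenCount .waiting X ≤ t)
    (hS : ∀ x ∈ X, x.2.2 = .source → x.1 = List.replicate t (Fin.last K, .source) ∧
      ∀ i < t, σ (List.replicate i (Fin.last K, .source)) (Fin.last K, .source) ≠ none)
    (o : Obs (towerGame K).obs₂) :
    TowerInvariant σ ((towerGame K).step σ (some false) o X) := by
  induction o using Quotient.inductionOn with | h q₀ => ?_
  have hsource : ∀ x ∈ X, x.2.2 = .source → x.2 = (Fin.last K, .source) := fun x hx hk =>
    Prod.ext ((hX x hx).trans hi) hk
  have hS1 : tokenCount .source X ≤ 1 := by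
    refine Finset.card_le_one.2 fun x hx y hy => ?_
    rw [Finset.mem_filter] at hx hy
    exact Prod.ext ((hS x hx.1 hx.2).1.trans (hS y hy.1 hy.2).1.symm)
      ((hsource x hx.1 hx.2).trans (hsource y hy.1 hy.2).symm)
  rcases step_phase_cases (σ := σ) (b := some false) (q₀ := q₀) hX with h | h | ⟨h0, h⟩ | h
  · change TowerInvariant σ ((towerGame K).step σ (some false) (obs _ q₀) X)
    rw [h]
    exact towerInvariant_empty
  · refine .inl ⟨fun z hz => (mem_step_phase z hz).trans h, ?_⟩
    refine tokenCount_step_eq_zero ?_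
    intro x hx q hq ho hk
    replace ho := obs_towerGame_eq_iff.1 ho
    rw [h] at ho
    rcases towerSuccs_active (mem_towerSuccs_of_phase hX hx hq) hk with h1 | h1
    · have := congrArg Fin.val (ho.symm.trans h1.1)
      exact hi0 (by simpa using this.symm)
    · exact absurd (ho.symm.trans h1.1).symm (Fin.succ_ne_zero i)
  · obtain ⟨j, hj⟩ := Fin.exists_succ_eq.2 h0
    have hne : q₀.1 ≠ i.succ := by
      rw [h]
      exact (Fin.castSucc_lt_succ).ne
    have hji : (j : ℕ) + 1 = i := by
      have := congrArg Fin.val (hj.trans h)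
      simpa using this
    refine .inr (.inl ⟨j, ?_, fun z hz => (mem_step_phase z hz).trans hj.symm,
      (tokenCount_source_step_le h0 hX).trans hS1, ?_⟩)
    · rw [hj, h]
      exact (Fin.castSucc_lt_last i).ne
    · have hW' := tokenCount_waiting_step_eq_zero (σ := σ) (b := some false) hne hX
      have hA' := tokenCount_active_step_le (σ := σ) (y := false) hne hX
      by_cases hadv : ∃ x ∈ X, x.2.2 = .source ∧ σ x.1 x.2 = none
      · left
        obtain ⟨x, hx, hk, hn⟩ := hadv
        rw [(hS x hx hk).1, hsource x hx hk] at hn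
        rw [hW', pow_zero, one_mul, hji]
        exact (hA'.trans hW).trans_lt (hσ t hn (hS x hx hk).2)
      · right
        refine ⟨tokenCount_step_eq_zero ?_, hW'⟩
        intro x hx q hq ho hk
        rw [obs_towerGame_eq_iff] at ho
        obtain ⟨h1, h2⟩ := towerSuccs_source (mem_towerSuccs_of_phase hX hx hq) hk (ho ▸ h0)
        rcases h2 with h2 | h2
        · exact hadv ⟨x, hx, h1, h2.2⟩
        · exact hne (ho.symm.trans h2.1)
  · refine .inr (.inr ⟨fun z hz => (mem_step_phase z hz).trans (h.trans hi), ?_, t + 1, ?_, ?_⟩)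
    · refine tokenCount_step_eq_zero ?_
      intro x hx q hq ho hk
      replace ho := obs_towerGame_eq_iff.1 ho
      rw [h] at ho
      rcases towerSuccs_active (mem_towerSuccs_of_phase hX hx hq) hk with h1 | h1
      · exact absurd (h1.1.symm.trans ho) (Fin.castSucc_lt_succ).ne
      · rw [tokenCount, Finset.card_eq_zero, Finset.filter_eq_empty_iff] at hA
        exact hA hx h1.2.1
    · exact (tokenCount_waiting_step_le hX).trans (Nat.add_le_add hW hS1)
    · intro z hz hk
      have hzp := mem_step_phase z hz
      obtain ⟨x, hx, h1, h2, -⟩ := (Game.mem_step _).1 hz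
      obtain ⟨hk', h3⟩ := towerSuccs_source (mem_towerSuccs_of_phase hX hx h2) hk
        (by rw [hzp, h]; exact Fin.succ_ne_zero i)
      have hn : σ x.1 x.2 ≠ none := by
        rcases h3 with h3 | h3
        · rw [hzp, h] at h3
          exact absurd h3.1.symm (Fin.castSucc_lt_succ).ne
        · exact h3.2
      rw [h1, (hS x hx hk').1, hsource x hx hk']
      rw [(hS x hx hk').1, hsource x hx hk'] at hn
      refine ⟨List.replicate_succ'.symm, fun l hl => ?_⟩
      rcases Nat.lt_succ_iff_lt_or_eq.1 hl with hl | rfl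
      · exact (hS x hx hk').2 l hl
      · exact hn

/-- A strategy that advances too early from the first phase does not win the tower game. -/
lemma not_positiveWinning_towerGame {σ : PureStrategy (TowerState K) (Option Bool)} (hK : 2 ≤ K)
    (hσ : ∀ t, σ (List.replicate t (Fin.last K, .source)) (Fin.last K, .source) = none →
      (∀ j < t, σ (List.replicate j (Fin.last K, .source)) (Fin.last K, .source) ≠ none) →
        t < tower (K - 1) 1) :
    ¬ (towerGame K).PositiveWinning (Fin.last K, .source) σ (Reach (towerTarget K)) := by
  have hlast : Fin.last K ≠ 0 := by
    intro h
    have := congrArg Fin.val h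
    simp at this
    lia
  refine (towerGame K).not_positiveWinning_of_invariant (TowerInvariant σ) ?_ ?_ ?_
  · exact .inr (.inr ⟨by simp, by simp [tokenCount, Finset.filter_singleton],
      0, by simp [tokenCount, Finset.filter_singleton], by simp⟩)
  · rintro X (⟨hX, hA⟩ | ⟨i, hi, hX, hS, hWA⟩ | ⟨hX, hA, t, hW, hS⟩)
    · exact ⟨none, fun o => towerInvariant_step_zero hX hA⟩
    · exact towerInvariant_step_succ hi hX hS hWA
    · obtain ⟨i, hi⟩ := Fin.exists_succ_eq.2 hlast
      have hiK : (i : ℕ) + 1 = K := by simpa using congrArg Fin.val hi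
      refine ⟨some false, towerInvariant_step_last (i := i) ?_ hi (by lia) ?_ hA hW hS⟩
      · rwa [show (i : ℕ) = K - 1 by lia]
      · rwa [hi]
  · rintro X (⟨hX, hA⟩ | ⟨i, hi, hX, hS, hWA⟩ | ⟨hX, hA, t, hW, hS⟩) x hx hxT
    all_goals
      rw [towerTarget, Set.mem_singleton_iff] at hxT
      have := hX x hx
      rw [hxT] at this
    · rw [tokenCount, Finset.card_eq_zero, Finset.filter_eq_empty_iff] at hA
      exact hA hx (by rw [hxT])
    · exact Fin.succ_ne_zero i this.symm
    · exact hlast this.symm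

end LowerBound

/-! ### A winning strategy for player 1 -/

section Winning

variable {K : ℕ}

/-- The winning strategy of player 1 in the tower game. It advances from phase `i + 1` after
`tower i 1` rounds. The active tokens of a phase are told apart by the numbers of rounds that they
have been waiting, and play the binary digits of these numbers. -/
def towerStrategy (K : ℕ) : PureStrategy (TowerState K) (Option Bool) := fun ρ q =>
  if ρ.countP (fun x => x.1 = q.1) = tower (q.1 - 1) 1 then none
  else some (Nat.testBit (ρ.countP (fun x => x.2 = .waiting) - 1)
    (ρ.countP fun x => x.2 = .active))

lemma observationBased_towerStrategy : ObservationBased (towerGame K).obs₁ (towerStrategy K) := by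
  intro ρ ρ' q q' h h'
  have hinj : Function.Injective (obs (towerGame K).obs₁) := fun x y hxy => Quotient.exact hxy
  rw [List.map_injective_iff.2 hinj h, hinj h']

lemma Game.Possible.append_replicate {Q A₁ A₂ : Type*} {G : Game Q A₁ A₂} {q₀ : Q}
    {σ : PureStrategy Q A₁} {π : RandStrategy Q A₂} {ρ : List Q} {q : Q}
    (h : G.Possible q₀ σ π ρ q) {n : ℕ}
    (hn : ∀ r < n, q ∈ (G.nextState σ π (ρ ++ List.replicate r q) q).support) :
    G.Possible q₀ σ π (ρ ++ List.replicate n q) q := by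
  induction n with
  | zero => simpa using h
  | succ n ih =>
    rw [List.replicate_succ', ← List.append_assoc]
    exact .snoc (ih fun r hr => hn r (by lia)) (hn n (by lia))

lemma mem_support_nextState_towerGame {i : Fin K} {f : List (Obs (towerGame K).obs₂) → Option Bool}
    {σ : PureStrategy (TowerState K) (Option Bool)} {ρ : List (TowerState K)} {k : Kind}
    {q : TowerState K} :
    q ∈ ((towerGame K).nextState σ (pureResponse _ f) ρ (i.succ, k)).support ↔
      q ∈ towerSuccs i k (σ ρ (i.succ, k)) (f ((ρ ++ [(i.succ, k)]).map (obs _))) := by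
  rw [Game.mem_support_nextState_pureResponse, mem_support_towerGame_trans_succ]

lemma countP_phase_append {d : Fin (K + 1)} {ρ l : List (TowerState K)} (h : ∀ x ∈ ρ, d < x.1)
    (hl : ∀ x ∈ l, x.1 = d) : (ρ ++ l).countP (fun x => x.1 = d) = l.length := by
  rw [List.countP_append, List.countP_eq_zero.2, List.countP_eq_length.2, zero_add]
  · simpa using hl
  · intro x hx
    simpa using (h x hx).ne'

lemma towerStrategy_eq_none {i : Fin K} {ρ l : List (TowerState K)} {k : Kind}
    (h : ∀ x ∈ ρ, i.succ < x.1) (hl : ∀ x ∈ l, x.1 = i.succ) (hn : l.length = tower i 1) :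
    towerStrategy K (ρ ++ l) (i.succ, k) = none := by
  rw [towerStrategy, if_pos]
  rw [countP_phase_append h hl, hn]
  simp

lemma towerStrategy_eq_some {i : Fin K} {ρ l : List (TowerState K)} {k : Kind}
    (h : ∀ x ∈ ρ, i.succ < x.1) (hl : ∀ x ∈ l, x.1 = i.succ) (hn : l.length < tower i 1) :
    towerStrategy K (ρ ++ l) (i.succ, k) =
      some (Nat.testBit ((ρ ++ l).countP (fun x => x.2 = .waiting) - 1)
        ((ρ ++ l).countP fun x => x.2 = .active)) := by
  rw [towerStrategy, if_neg]
  rw [countP_phase_append h hl]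
  simpa using hn.ne

/-- The phase `d` is entered by the source and, unless `d` is the first phase, by `tower d 1` active
tokens, all of them with the same observations for player 2. -/
def TowerReached (f : List (Obs (towerGame K).obs₂) → Option Bool) (d : Fin (K + 1)) : Prop :=
  ∃ H : List (TowerState K), (∀ x ∈ H, d < x.1 ∧ x.2 = .source) ∧
    (towerGame K).Possible (Fin.last K, .source) (towerStrategy K) (pureResponse _ f) H
      (d, .source) ∧
    (d ≠ Fin.last K → ∀ w, 1 ≤ w → w ≤ tower d 1 → ∃ ρ : List (TowerState K),
      ρ.map (obs (towerGame K).obs₂) = H.map (obs _) ∧ (∀ x ∈ ρ, d < x.1) ∧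
      ρ.countP (fun x => x.2 = .waiting) = w ∧ ρ.countP (fun x => x.2 = .active) = 0 ∧
      (towerGame K).Possible (Fin.last K, .source) (towerStrategy K) (pureResponse _ f) ρ
        (d, .active))

/-- Player 2 sees phases only, so tokens with equally timed phases receive the same answers from
him. -/
lemma map_obs_append_phase {d : Fin (K + 1)} {ρ H l : List (TowerState K)} {q : TowerState K}
    (h : ρ.map (obs (towerGame K).obs₂) = H.map (obs _)) (hl : ∀ x ∈ l, x.1 = d) (hq : q.1 = d) :
    ((ρ ++ l) ++ [q]).map (obs (towerGame K).obs₂) =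
      H.map (obs _) ++ List.replicate (l.length + 1) (obs _ (d, .source)) := by
  rw [List.append_assoc, List.map_append, h]
  congr 1
  refine List.eq_replicate_iff.2 ⟨by simp, fun b hb => ?_⟩
  obtain ⟨x, hx, rfl⟩ := List.mem_map.1 hb
  rw [obs_towerGame_eq_iff]
  rcases List.mem_append.1 hx with hx | hx
  · exact hl x hx
  · rw [List.mem_singleton.1 hx, hq]

/-- The active tokens of phase `i + 1` carry all bit strings of length `tower i 1`, so one of them
matches player 2's answers up to any challenge and would then reach the target. Hence he never
challenges with effect in this phase, and the source emits a token in each of `tower i 1` rounds,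
with distinct waiting times. -/
lemma TowerReached.castSucc {f : List (Obs (towerGame K).obs₂) → Option Bool} {i : Fin K}
    (hT : ∀ ρ q, (towerGame K).Possible (Fin.last K, .source) (towerStrategy K) (pureResponse _ f)
      ρ q → q ∉ towerTarget K)
    (h : TowerReached f i.succ) : TowerReached f i.castSucc := by
  obtain ⟨H, hH, hP, hA⟩ := h
  let y : ℕ → Option Bool := fun r =>
    f (H.map (obs _) ++ List.replicate (r + 1) (obs _ (i.succ, .source)))
  have hy : ∀ {ρ l : List (TowerState K)} {k : Kind},
      ρ.map (obs (towerGame K).obs₂) = H.map (obs _) → (∀ x ∈ l, x.1 = i.succ) →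
      f (((ρ ++ l) ++ [(i.succ, k)]).map (obs _)) = y l.length := fun h1 h2 =>
    congrArg f (map_obs_append_phase h1 h2 rfl)
  have hHp : ∀ x ∈ H, i.succ < x.1 := fun x hx => (hH x hx).1
  have hrep : ∀ (r : ℕ) (k : Kind), ∀ x ∈ List.replicate r ((i.succ, k) : TowerState K),
      x.1 = i.succ := by
    intro r k x hx
    rw [List.eq_of_mem_replicate hx]
  -- challenges are answered by an active token
  have hch : i.succ ≠ Fin.last K → ∀ r ≤ tower i 1, y r ≠ none := by
    intro hi r
    induction r using Nat.strong_induction_on with | _ r ih => ?_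
    intro hr hnone
    -- The number spelled by player 2's answers; the digits from round `r` on do not matter. The
    -- token needed has waited `m + 1` rounds, because the strategy reads the digits of the waiting
    -- time minus one.
    let m := Nat.ofBits fun j : Fin (tower i 1) => (y j).getD false
    have hm : ∀ j < r, y j = some (m.testBit j) := by
      intro j hj
      rw [Nat.testBit_ofBits_lt _ _ (by lia)]
      obtain ⟨b, hb⟩ := Option.ne_none_iff_exists'.1 (ih j hj (by lia))
      simp [hb]
    have hm2 : m + 1 ≤ tower i.succ 1 := by
      rw [Fin.val_succ, tower]
      exact Nat.ofBits_lt_two_pow _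
    obtain ⟨ρ, h1, h2, h3, h4, h5⟩ := hA hi (m + 1) (by lia) hm2
    have hpos := h5.append_replicate (n := r) fun j hj => by
      rw [mem_support_nextState_towerGame, hy h1 (hrep j _),
        towerStrategy_eq_some h2 (hrep j _) (by rw [List.length_replicate]; lia),
        List.length_replicate, hm j hj]
      simp [towerSuccs, List.countP_append, h3, h4, List.countP_replicate]
    -- A challenge takes precedence over the move of player 1, so this also covers the round `r =
    -- tower i 1`, in which he advances.
    refine hT _ (0, .active) (hpos.snoc ?_) rfl
    rw [mem_support_nextState_towerGame, hy h1 (hrep r _), List.length_replicate, hnone]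
    simp [towerSuccs]
  have hno : ∀ r ≤ tower i 1, ¬ (y r = none ∧ i.succ ≠ Fin.last K) := fun r hr h =>
    hch h.2 r hr h.1
  have hsource : ∀ n ≤ tower i 1, (towerGame K).Possible (Fin.last K, .source) (towerStrategy K)
      (pureResponse _ f) (H ++ List.replicate n (i.succ, .source)) (i.succ, .source) := by
    intro n hn
    refine hP.append_replicate fun j hj => ?_
    rw [mem_support_nextState_towerGame, hy rfl (hrep j _),
      towerStrategy_eq_some hHp (hrep j _) (by rw [List.length_replicate]; lia),
      List.length_replicate, towerSuccs, if_neg (hno j (by lia))]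
    simp
  refine ⟨H ++ List.replicate (tower i 1) (i.succ, .source) ++ [(i.succ, .source)], ?_, ?_, ?_⟩
  · intro x hx
    simp only [List.mem_append, List.mem_replicate, List.mem_singleton] at hx
    rcases hx with (hx | ⟨-, rfl⟩) | rfl
    · exact ⟨(Fin.castSucc_lt_succ).trans (hH x hx).1, (hH x hx).2⟩
    · exact ⟨Fin.castSucc_lt_succ, rfl⟩
    · exact ⟨Fin.castSucc_lt_succ, rfl⟩
  · refine (hsource _ le_rfl).snoc ?_
    rw [mem_support_nextState_towerGame, hy rfl (hrep _ _),
      towerStrategy_eq_none hHp (hrep _ _) List.length_replicate, List.length_replicate, towerSuccs,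
      if_neg (hno _ le_rfl)]
    simp
  · intro _ w hw1 hw2
    rw [Fin.val_castSucc] at hw2
    -- A token emitted after `tower i 1 - w + 1` source states waits for exactly `w` rounds before
    -- the common advance.
    let l : ℕ → List (TowerState K) := fun r =>
      List.replicate (tower i 1 - w + 1) (i.succ, .source) ++ List.replicate r (i.succ, .waiting)
    have hl : ∀ r, ∀ x ∈ l r, x.1 = i.succ := by
      intro r x hx
      rcases List.mem_append.1 hx with hx | hx
      · exact hrep _ _ x hx
      · exact hrep _ _ x hx
    have hlen : ∀ r, (l r).length = tower i 1 - w + 1 + r := by simp [l]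
    have hwait : ∀ r < w, (towerGame K).Possible (Fin.last K, .source) (towerStrategy K)
        (pureResponse _ f) (H ++ l r) (i.succ, .waiting) := by
      intro r hr
      have h0 : (towerGame K).Possible (Fin.last K, .source) (towerStrategy K)
          (pureResponse _ f) (H ++ List.replicate (tower i 1 - w + 1) (i.succ, .source))
          (i.succ, .waiting) := by
        rw [List.replicate_succ', ← List.append_assoc]
        refine (hsource _ (by lia)).snoc ?_
        rw [mem_support_nextState_towerGame, hy rfl (hrep _ _),
          towerStrategy_eq_some hHp (hrep _ _) (by rw [List.length_replicate]; lia),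
          List.length_replicate, towerSuccs, if_neg (hno _ (by lia))]
        simp
      have h1 := h0.append_replicate (n := r) fun j hj => by
        rw [List.append_assoc]
        change _ ∈ ((towerGame K).nextState _ _ (H ++ l j) _).support
        rw [mem_support_nextState_towerGame, hy rfl (hl j),
          towerStrategy_eq_some hHp (hl j) (by rw [hlen]; lia), hlen, towerSuccs,
          if_neg (hno _ (by lia))]
        simp
      rwa [List.append_assoc] at h1
    refine ⟨H ++ l (w - 1) ++ [(i.succ, .waiting)], ?_, ?_, ?_, ?_, ?_⟩
    · rw [map_obs_append_phase rfl (hl _) rfl, map_obs_append_phase rfl (hrep _ _) rfl, hlen,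
        List.length_replicate, show tower i 1 - w + 1 + (w - 1) = tower i 1 by lia]
    · intro x hx
      rw [List.append_assoc, List.mem_append] at hx
      rcases hx with hx | hx
      · exact (Fin.castSucc_lt_succ).trans (hHp x hx)
      · have : x.1 = i.succ := by
          rcases List.mem_append.1 hx with hx | hx
          · exact hl _ x hx
          · rw [List.mem_singleton.1 hx]
        rw [this]
        exact Fin.castSucc_lt_succ
    · have hH0 : H.countP (fun x => x.2 = .waiting) = 0 :=
        List.countP_eq_zero.2 fun x hx => by simp [(hH x hx).2]
      simp only [l, List.countP_append, hH0, List.countP_replicate, List.countP_singleton]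
      simp
      lia
    · have hH0 : H.countP (fun x => x.2 = .active) = 0 :=
        List.countP_eq_zero.2 fun x hx => by simp [(hH x hx).2]
      simp [l, List.countP_append, hH0, List.countP_replicate]
    · refine (hwait (w - 1) (by lia)).snoc ?_
      rw [mem_support_nextState_towerGame, hy rfl (hl _),
        towerStrategy_eq_none hHp (hl _) (by rw [hlen]; lia), hlen, towerSuccs,
        if_neg (hno _ (by lia))]
      simp

lemma positiveWinning_towerStrategy (hK : 1 ≤ K) :
    (towerGame K).PositiveWinning (Fin.last K, .source) (towerStrategy K)
      (Reach (towerTarget K)) := by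
  rw [Game.positiveWinning_reach_iff]
  intro f
  by_contra hc
  have hT : ∀ ρ q, (towerGame K).Possible (Fin.last K, .source) (towerStrategy K)
      (pureResponse _ f) ρ q → q ∉ towerTarget K := fun ρ q h1 h2 => hc ⟨ρ, q, h1, h2⟩
  have hall : ∀ n : ℕ, ∀ d : Fin (K + 1), (d : ℕ) + n = K → TowerReached f d := by
    intro n
    induction n with
    | zero =>
      intro d hd
      have : d = Fin.last K := Fin.ext hd
      subst this
      exact ⟨[], by simp, .nil, fun h => absurd rfl h⟩
    | succ n ih =>
      intro d hd
      exact (ih (Fin.succ ⟨d, by lia⟩) (by simp; lia)).castSucc hT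
  obtain ⟨H, -, -, hA⟩ := hall K 0 (by simp)
  have hlast : (0 : Fin (K + 1)) ≠ Fin.last K := by
    intro h
    have := congrArg Fin.val h
    simp at this
    lia
  -- Phase `0` is entered by `tower 0 1 = 1` active token, which is in the target.
  obtain ⟨ρ, -, -, -, -, hp⟩ := hA hlast 1 le_rfl le_rfl
  exact hT _ _ hp rfl

end Winning

/-! ### Arithmetic of towers -/

lemma tower_add (k m x : ℕ) : tower (k + m) x = tower k (tower m x) := by
  induction k with
  | zero => rw [Nat.zero_add]; rfl
  | succ k ih => rw [Nat.succ_add, tower, tower, ih]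

lemma tower_mono (k : ℕ) : Monotone (tower k) := by
  induction k with
  | zero => exact monotone_id
  | succ k ih => exact fun x y h => Nat.pow_le_pow_right (by norm_num) (ih h)

lemma le_tower (m : ℕ) : m ≤ tower m 1 := by
  induction m with
  | zero => exact Nat.zero_le _
  | succ m ih => exact ih.trans_lt Nat.lt_two_pow_self

/-- The argument `3 * (K + 1) + 6` is the size of the tower game: its states and twice three
actions. It is linear in `K`, whereas `K - 1` exceeds `k` by enough exponentials to dominate it. -/
lemma exists_tower_game (k : ℕ) : ∃ K, 2 ≤ K ∧ tower k (3 * (K + 1) + 6) ≤ tower (K - 1) 1 := by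
  -- Stripping `k` exponentials leaves `6 * k + 45 ≤ tower (k + 11) 1`, and the right side is at
  -- least `1024 * 2 ^ k`.
  refine ⟨k + (k + 11) + 1, by lia, ?_⟩
  rw [Nat.add_sub_cancel, tower_add]
  refine tower_mono k ?_
  have h1 : 2 ^ (k + 10) ≤ tower (k + 11) 1 :=
    Nat.pow_le_pow_right (by norm_num) (le_tower (k + 10))
  have h2 : k < 2 ^ k := Nat.lt_two_pow_self
  rw [pow_add] at h1
  norm_num at h1
  lia

end PartialObs

theorem mainTheorem7 :
    -- positive reachability together with almost-sure safety: finite memory suffices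
    (∀ (Q : Type*) (A₁ : Type*) (A₂ : Type*) [Finite Q] [Finite A₁] [Finite A₂]
        (G : PartialObs.Game Q A₁ A₂) (q : Q) (T S : Set Q),
        (∃ σ : PartialObs.PureStrategy Q A₁, PartialObs.ObservationBased G.obs₁ σ ∧
          G.PositiveWinning q σ (PartialObs.Reach T) ∧
          G.AlmostSureWinning q σ (PartialObs.Safe S)) →
        ∃ σ : PartialObs.PureStrategy Q A₁, PartialObs.ObservationBased G.obs₁ σ ∧
          PartialObs.FiniteMemory G.obs₁ σ ∧
          G.PositiveWinning q σ (PartialObs.Reach T) ∧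
          G.AlmostSureWinning q σ (PartialObs.Safe S)) ∧
    -- positive winning for reachability: finite memory suffices
    (∀ (Q : Type*) (A₁ : Type*) (A₂ : Type*) [Finite Q] [Finite A₁] [Finite A₂]
        (G : PartialObs.Game Q A₁ A₂) (q : Q) (T : Set Q),
        (∃ σ : PartialObs.PureStrategy Q A₁, PartialObs.ObservationBased G.obs₁ σ ∧
          G.PositiveWinning q σ (PartialObs.Reach T)) →
        ∃ σ : PartialObs.PureStrategy Q A₁, PartialObs.ObservationBased G.obs₁ σ ∧
          PartialObs.FiniteMemory G.obs₁ σ ∧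
          G.PositiveWinning q σ (PartialObs.Reach T)) ∧
    -- positive winning for reachability: no elementary function of the size of the game
    -- bounds the memory that is needed
    (∀ k : ℕ, ∃ (Q : Type) (A₁ : Type) (A₂ : Type) (_ : Finite Q) (_ : Finite A₁) (_ : Finite A₂)
        (G : PartialObs.Game Q A₁ A₂) (q : Q) (T : Set Q),
        (∃ σ : PartialObs.PureStrategy Q A₁, PartialObs.ObservationBased G.obs₁ σ ∧
          G.PositiveWinning q σ (PartialObs.Reach T)) ∧
        ∀ (Mem : Type) [Finite Mem]
          (τ : PartialObs.Transducer (PartialObs.Obs G.obs₁) A₁ Mem),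
          G.PositiveWinning q τ.strategy (PartialObs.Reach T) →
          PartialObs.tower k (Nat.card Q + Nat.card A₁ + Nat.card A₂) < Nat.card Mem) := by
  refine ⟨?_, ?_, ?_⟩
  · rintro Q A₁ A₂ _ _ _ G q T S ⟨σ, hσ, hT, hS⟩
    exact G.exists_finiteMemory q T S hσ hT hS
  · rintro Q A₁ A₂ _ _ _ G q T ⟨σ, hσ, hT⟩
    obtain ⟨σ', h1, h2, h3, -⟩ :=
      G.exists_finiteMemory q T Set.univ hσ hT (G.almostSureWinning_safe_univ q σ)
    exact ⟨σ', h1, h2, h3⟩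
  · intro k
    obtain ⟨K, hK, hk⟩ := PartialObs.exists_tower_game k
    refine ⟨PartialObs.TowerState K, Option Bool, Option Bool, inferInstance, inferInstance,
      inferInstance, PartialObs.towerGame K, (Fin.last K, .source), PartialObs.towerTarget K,
      ⟨PartialObs.towerStrategy K, PartialObs.observationBased_towerStrategy,
        PartialObs.positiveWinning_towerStrategy (by lia)⟩, ?_⟩
    intro Mem _ τ hτ
    by_contra hle
    refine PartialObs.not_positiveWinning_towerGame hK (fun t ht hlt => ?_) hτ
    refine (τ.lt_card_of_first _ _ t ht hlt).trans_le ((not_lt.1 hle).trans (le_trans ?_ hk))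
    refine PartialObs.tower_mono k (le_of_eq ?_)
    have hkind : Fintype.card PartialObs.Kind = 3 := rfl
    simp only [Nat.card_eq_fintype_card, Fintype.card_prod, Fintype.card_fin, Fintype.card_option,
      Fintype.card_bool, hkind]
    lia
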